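/- Let $H_1, H_2 \subset \mathbb{R}^2$ be disjoint bounded convex sets. A \emph{closed billiard table} is a compact connected set $K \subset \mathbb{R}^2$ with nonempty interior and $C^2$ boundary: near each boundary point $q$ there is a $C^2$ function $f$ with $f(q)=0$, $\nabla f(q)\neq 0$ and $K=\{f\ge 0\}$; the inward unit normal is $\nu(q)=\nabla f(q)/\|\nabla f(q)\|$. A \emph{light ray} in $K$ from a candle $p\in K$ starts at $p$ in a unit direction $v$ (with $\langle v,\nu(p)\rangle\ge 0$ if $p\in\partial K$), runs along straight segments contained in $K$ (which may graze the boundary), and whenever it meets $\partial K$ at a point $q$ with direction $v^-$ satisfying $\langle v^-,\nu(q)\rangle<0$ it is reflected to the direction $v^+=v^--2\langle v^-,\nu(q)\rangle\,\nu(q)$. A set $S$ is \emph{dark} for the candle $p$ if no light ray from $p$ reaches a point of $S$ after finite time and finitely many reflections. Then for every $\varepsilon>0$ there is a closed billiard table $K$ such that 1. the walls overlap each $H_i$ only a little: for $i=1,2$, the part $H_i\setminus K$ of $H_i$ outside the table has area less than $\varepsilon$, and every point of $H_i$ is within distance less than $\varepsilon$ of some point of $H_i\cap K$; 2. for every candle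 position $p\in K$, at least one of the sets $H_1\cap K$ and $H_2\cap K$ (the parts of $H_1$ and $H_2$ inside the table) is dark. -/

import Mathlib

/-- The Euclidean plane. -/
abbrev Plane : Type := EuclideanSpace ℝ (Fin 2)

/-- Near the boundary point `q`, the set `K` is `{f ≥ 0}` for a `C²` function `f` with
`f q = 0` and nonvanishing gradient at `q`, and `ν` is the unit vector in the direction of that
gradient, i.e. the unit normal to the boundary of `K` at `q` that points into `K`. -/
def IsInwardUnitNormal (K : Set Plane) (q ν : Plane) : Prop :=
  ∃ (U : Set Plane) (f : Plane → ℝ), IsOpen U ∧ q ∈ U ∧ ContDiffOn ℝ 2 f U ∧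
    (∀ x ∈ U, x ∈ K ↔ 0 ≤ f x) ∧ f q = 0 ∧ gradient f q ≠ 0 ∧
    ν = ‖gradient f q‖⁻¹ • gradient f q

/-- The inward unit normal at a boundary point is unique: it depends on `K` only and not on the
chosen defining function. -/
theorem IsInwardUnitNormal.unique {K : Set Plane} {q ν ν' : Plane}
    (h : IsInwardUnitNormal K q ν) (h' : IsInwardUnitNormal K q ν') : ν = ν' := by
  have key : ∀ {f : Plane → ℝ} {U : Set Plane} (w : Plane), IsOpen U → q ∈ U →
      ContDiffOn ℝ 2 f U → f q = 0 →
      HasDerivAt (fun t : ℝ => f (q + t • w)) (inner ℝ (gradient f q) w) 0 := by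
    intro f U w hU hq hf _
    have hd : DifferentiableAt ℝ f q :=
      (hf.contDiffAt (hU.mem_nhds hq)).differentiableAt (by norm_num)
    have h1 : HasFDerivAt f (InnerProductSpace.toDual ℝ Plane (gradient f q)) (q + (0 : ℝ) • w) := by
      simpa using hd.hasGradientAt.hasFDerivAt
    have h2 : HasDerivAt (fun t : ℝ => q + t • w) w 0 := by
      simpa using ((hasDerivAt_id (0 : ℝ)).smul_const w).const_add q
    have h3 := h1.comp_hasDerivAt (0 : ℝ) h2
    rw [InnerProductSpace.toDual_apply_apply] at h3
    exact h3
  obtain ⟨U, f, hU, hqU, hf, hK, hf0, hg, rfl⟩ := h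
  obtain ⟨V, g, hV, hqV, hg', hK', hg0, hgg, rfl⟩ := h'
  set a := ‖gradient f q‖⁻¹ • gradient f q with ha
  set b := ‖gradient g q‖⁻¹ • gradient g q with hb
  have na : ‖a‖ = 1 := by rw [ha, norm_smul, norm_inv, norm_norm, inv_mul_cancel₀ (by simpa using hg)]
  have nb : ‖b‖ = 1 := by rw [hb, norm_smul, norm_inv, norm_norm, inv_mul_cancel₀ (by simpa using hgg)]
  by_contra hne
  have hlt : inner ℝ a b < 1 := by
    have := (inner_lt_one_iff_real_of_norm_eq_one na nb).2 hne
    exact this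
  have ea : gradient f q = ‖gradient f q‖ • a := by
    rw [ha, smul_smul, mul_inv_cancel₀ (by simpa using hg), one_smul]
  have eb : gradient g q = ‖gradient g q‖ • b := by
    rw [hb, smul_smul, mul_inv_cancel₀ (by simpa using hgg), one_smul]
  have pa : 0 < inner ℝ (gradient f q) (a - b) := by
    rw [ea, real_inner_smul_left, inner_sub_right, real_inner_self_eq_norm_sq, na]
    exact mul_pos (norm_pos_iff.2 hg) (by linarith)
  have pb : inner ℝ (gradient g q) (a - b) < 0 := by
    rw [eb, real_inner_smul_left, inner_sub_right, real_inner_self_eq_norm_sq, nb,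
      real_inner_comm]
    exact mul_neg_of_pos_of_neg (norm_pos_iff.2 hgg) (by linarith)
  have d1 := (key (a - b) hU hqU hf hf0).hasDerivWithinAt (s := Set.Ioi 0)
  have d2 := (key (a - b) hV hqV hg' hg0).hasDerivWithinAt (s := Set.Ioi 0)
  rw [hasDerivWithinAt_iff_tendsto_slope' (by simp)] at d1 d2
  have c : Filter.Tendsto (fun t : ℝ => q + t • (a - b)) (nhdsWithin 0 (Set.Ioi 0)) (nhds q) := by
    have : Continuous (fun t : ℝ => q + t • (a - b)) := by fun_prop
    simpa using (this.tendsto 0).mono_left nhdsWithin_le_nhds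
  have e := (d1.eventually (lt_mem_nhds pa)).and ((d2.eventually (gt_mem_nhds pb)).and
    ((c.eventually (hU.mem_nhds hqU)).and ((c.eventually (hV.mem_nhds hqV)).and
      self_mem_nhdsWithin)))
  obtain ⟨t, h1, h2, h3, h4, h5⟩ := e.exists
  have ht : (0 : ℝ) < t := h5
  simp only [slope_def_field, zero_smul, add_zero, hf0, hg0, sub_zero] at h1 h2
  have q1 : 0 < f (q + t • (a - b)) := (div_pos_iff_of_pos_right ht).1 h1
  have q2 : g (q + t • (a - b)) < 0 := by
    by_contra hcon
    exact absurd (div_nonneg (not_lt.1 hcon) ht.le) (not_le.2 h2)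
  exact absurd ((hK' _ h4).1 ((hK _ h3).2 q1.le)) (not_le.2 q2)

/-- A closed billiard table (a mirrored room): a compact connected subset of the plane with
nonempty interior and `C²` boundary. -/
structure IsClosedBilliardTable (K : Set Plane) : Prop where
  isCompact : IsCompact K
  isConnected : IsConnected K
  interior_nonempty : (interior K).Nonempty
  boundary : ∀ q ∈ frontier K, ∃ ν, IsInwardUnitNormal K q ν

/-- `LightRay K p x v`: a light ray that leaves the candle `p` in some unit direction (not
pointing into the wall, if `p` is on the boundary) and follows the billiard flow in the table `K`
arrives, after finite time and finitely many reflections, at the point `x` with direction `v`.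
Between reflections the ray runs straight and stays in `K` (it may graze the boundary). -/
inductive LightRay (K : Set Plane) (p : Plane) : Plane → Plane → Prop
  | start (v : Plane) (hv : ‖v‖ = 1)
      (hp : ∀ ν, IsInwardUnitNormal K p ν → 0 ≤ inner ℝ v ν) : LightRay K p p v
  | move (x v : Plane) (t : ℝ) (h : LightRay K p x v) (ht : 0 ≤ t)
      (hK : segment ℝ x (x + t • v) ⊆ K) : LightRay K p (x + t • v) v
  | reflect (x v ν : Plane) (h : LightRay K p x v) (hν : IsInwardUnitNormal K x ν)
      (hv : inner ℝ v ν < 0) : LightRay K p x (v - (2 * inner ℝ v ν) • ν)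

/-- The region `S` is dark when the candle stands at `p` in the table `K`: no light ray from `p`
ever reaches a point of `S`. -/
def IsDark (K : Set Plane) (p : Plane) (S : Set Plane) : Prop :=
  ∀ x ∈ S, ∀ v, ¬ LightRay K p x v

/-- The overlap of `H` with the walls (the complement of the table `K`) is `ε`-small: it has area
less than `ε`, and every point of `H` is within distance `ε` of the part of `H` inside the table.
(The second clause gives the smallness a meaning for segments and points, which have no area.) -/
def SmallOverlap (K H : Set Plane) (ε : ℝ) : Prop :=
  MeasureTheory.volume (H \ K) < ENNReal.ofReal ε ∧ ∀ x ∈ H, ∃ y ∈ H ∩ K, dist x y < ε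

/-! The table is a Penrose room. Its caps beyond `|y| = 1` are halves of ellipses with semi-axes
`√17` and `4`, hence with foci `(±1, ±1)`. An obstacle touches the lines `|y| = 1` exactly at the
four foci. Between the upper foci and above the obstacle lies the upper stem, which opens into the
upper cap only through the open focal segment; the lower stem is its mirror image.

Within a cap, the product of the angular momenta about the two foci is constant along segments and
under reflection in the ellipse (`momenta_reflect`). Its sign tells whether the line of the ray
crosses the focal line inside or outside the focal segment. So light that enters the upper cap
beside the segment never leaves through it: `Outside` is invariant, and the upper stem is dark for
every candle below the cap and off that stem (`isDark_stem`). Any other candle is in the upper cap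
or stem, and then the lower stem is dark by symmetry (`isDark_stem_or`).

It remains to put `H₁` and `H₂` near the origin on the two sides of a separating line and to make
the obstacle thin there, so that the parts inside the table lie in opposite stems. The delicate case
is a set that meets the line itself. At the points of a finite `ε`-net on the line the obstacle is
bent so that its edge passes through the net point, with the obstacle on the other set's side
(`exists_profile`); disjointness makes these demands compatible. -/

/-! ### Orthonormal coordinates, gradients and reflections. -/

/-- An orthonormal frame of the plane with an origin and a length unit. -/
structure PlaneFrame where
  /-- The origin. -/
  o : Plane
  /-- The direction of the first axis. -/
  e₁ : Plane
  /-- The direction of the second axis. -/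
  e₂ : Plane
  /-- The unit of length. -/
  c : ℝ
  c_pos : 0 < c
  norm_e₁ : ‖e₁‖ = 1
  norm_e₂ : ‖e₂‖ = 1
  inner_e : inner ℝ e₁ e₂ = 0
  expand : ∀ w : Plane, w = inner ℝ e₁ w • e₁ + inner ℝ e₂ w • e₂

namespace PlaneFrame

variable (F : PlaneFrame)

/-- First coordinate of a vector. -/
noncomputable def dx (v : Plane) : ℝ := inner ℝ F.e₁ v / F.c

/-- Second coordinate of a vector. -/
noncomputable def dy (v : Plane) : ℝ := inner ℝ F.e₂ v / F.c

/-- First coordinate of a point. -/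
noncomputable def x (z : Plane) : ℝ := F.dx (z - F.o)

/-- Second coordinate of a point. -/
noncomputable def y (z : Plane) : ℝ := F.dy (z - F.o)

/-- The point with given coordinates. -/
noncomputable def pt (a b : ℝ) : Plane := F.o + F.c • (a • F.e₁ + b • F.e₂)

/-- The frame with the second axis reversed. -/
def flip : PlaneFrame where
  o := F.o
  e₁ := F.e₁
  e₂ := -F.e₂
  c := F.c
  c_pos := F.c_pos
  norm_e₁ := F.norm_e₁
  norm_e₂ := by rw [norm_neg]; exact F.norm_e₂
  inner_e := by rw [inner_neg_right, F.inner_e, neg_zero]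
  expand w := by rw [inner_neg_left, smul_neg, neg_smul, neg_neg]; exact F.expand w

@[simp] theorem flip_x (z : Plane) : F.flip.x z = F.x z := rfl

@[simp] theorem flip_y (z : Plane) : F.flip.y z = -F.y z := by
  simp [y, dy, flip, neg_div]

theorem inner_e' : inner ℝ F.e₂ F.e₁ = 0 := by rw [real_inner_comm]; exact F.inner_e

theorem inner_e₁_self : inner ℝ F.e₁ F.e₁ = 1 := by
  rw [real_inner_self_eq_norm_sq, F.norm_e₁]; norm_num

theorem inner_e₂_self : inner ℝ F.e₂ F.e₂ = 1 := by
  rw [real_inner_self_eq_norm_sq, F.norm_e₂]; norm_num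

@[simp] theorem x_pt (a b : ℝ) : F.x (F.pt a b) = a := by
  have := F.c_pos.ne'
  simp [x, dx, pt, inner_add_right, inner_smul_right, F.inner_e, F.norm_e₁]
  field_simp

@[simp] theorem y_pt (a b : ℝ) : F.y (F.pt a b) = b := by
  have := F.c_pos.ne'
  simp [y, dy, pt, inner_add_right, inner_smul_right, F.inner_e', F.norm_e₂]
  field_simp

theorem pt_xy (z : Plane) : F.pt (F.x z) (F.y z) = z := by
  have := F.c_pos.ne'
  have h := F.expand (z - F.o)
  simp only [pt, x, y, dx, dy, smul_add, smul_smul, mul_div_cancel₀ _ this]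
  rw [← h]; abel

theorem x_move (z v : Plane) (t : ℝ) : F.x (z + t • v) = F.x z + t * F.dx v := by
  simp only [x, dx, inner_sub_right, inner_add_right, inner_smul_right]; ring

theorem y_move (z v : Plane) (t : ℝ) : F.y (z + t • v) = F.y z + t * F.dy v := by
  simp only [y, dy, inner_sub_right, inner_add_right, inner_smul_right]; ring

theorem hasFDerivAt_x (z : Plane) : HasFDerivAt F.x (F.c⁻¹ • innerSL ℝ F.e₁) z := by
  have h : F.x = fun w => (F.c⁻¹ • innerSL ℝ F.e₁) w - (F.c⁻¹ • innerSL ℝ F.e₁) F.o := by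
    ext w; simp [x, dx, div_eq_inv_mul, inner_sub_right]; ring
  rw [h]
  exact (F.c⁻¹ • innerSL ℝ F.e₁).hasFDerivAt.sub_const _

theorem hasFDerivAt_y (z : Plane) : HasFDerivAt F.y (F.c⁻¹ • innerSL ℝ F.e₂) z := by
  have h : F.y = fun w => (F.c⁻¹ • innerSL ℝ F.e₂) w - (F.c⁻¹ • innerSL ℝ F.e₂) F.o := by
    ext w; simp [y, dy, div_eq_inv_mul, inner_sub_right]; ring
  rw [h]
  exact (F.c⁻¹ • innerSL ℝ F.e₂).hasFDerivAt.sub_const _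

theorem contDiff_x : ContDiff ℝ 2 F.x := by
  have h : F.x = fun w => (F.c⁻¹ • innerSL ℝ F.e₁) (w - F.o) := by
    ext w; simp [x, dx, div_eq_inv_mul]
  rw [h]
  exact (F.c⁻¹ • innerSL ℝ F.e₁).contDiff.comp (contDiff_id.sub contDiff_const)

theorem contDiff_y : ContDiff ℝ 2 F.y := by
  have h : F.y = fun w => (F.c⁻¹ • innerSL ℝ F.e₂) (w - F.o) := by
    ext w; simp [y, dy, div_eq_inv_mul]
  rw [h]
  exact (F.c⁻¹ • innerSL ℝ F.e₂).contDiff.comp (contDiff_id.sub contDiff_const)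

theorem continuous_x : Continuous F.x := F.contDiff_x.continuous

theorem continuous_y : Continuous F.y := F.contDiff_y.continuous

/-- The vector dual to `a dx + b dy`. -/
noncomputable def grad (a b : ℝ) : Plane := F.c⁻¹ • (a • F.e₁ + b • F.e₂)

theorem gradient_eq {f : Plane → ℝ} {z : Plane} {a b : ℝ}
    (h : HasFDerivAt f (a • (F.c⁻¹ • innerSL ℝ F.e₁) + b • (F.c⁻¹ • innerSL ℝ F.e₂)) z) :
    gradient f z = F.grad a b := by
  apply HasGradientAt.gradient
  rw [hasGradientAt_iff_hasFDerivAt]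
  refine h.congr_fderiv ?_
  refine ContinuousLinearMap.ext fun w => ?_
  simp [grad]
  ring

theorem norm_grad_sq (a b : ℝ) : ‖F.grad a b‖ ^ 2 = (a ^ 2 + b ^ 2) / F.c ^ 2 := by
  rw [← real_inner_self_eq_norm_sq]
  simp only [grad, inner_add_left, inner_add_right, inner_smul_left, inner_smul_right,
    F.inner_e, F.inner_e', F.inner_e₁_self, F.inner_e₂_self]
  simp; field_simp

theorem grad_ne_zero {a b : ℝ} (h : a ≠ 0 ∨ b ≠ 0) : F.grad a b ≠ 0 := by
  intro h0
  have h1 := F.norm_grad_sq a b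
  have hc := F.c_pos
  rw [h0, norm_zero, zero_pow two_ne_zero, eq_comm, div_eq_zero_iff] at h1
  have h2 : a ^ 2 + b ^ 2 = 0 := h1.resolve_right (by positivity)
  rcases h with h | h
  · exact h (by nlinarith [sq_nonneg a, sq_nonneg b])
  · exact h (by nlinarith [sq_nonneg a, sq_nonneg b])

/-- Reflection in the line orthogonal to `grad a b`, in coordinates. -/
theorem reflect_coords {a b : ℝ} (h : a ≠ 0 ∨ b ≠ 0) (v ν : Plane)
    (hν : ν = ‖F.grad a b‖⁻¹ • F.grad a b) :
    F.dx (v - (2 * inner ℝ v ν) • ν)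
        = F.dx v - 2 * ((a * F.dx v + b * F.dy v) / (a ^ 2 + b ^ 2)) * a ∧
      F.dy (v - (2 * inner ℝ v ν) • ν)
        = F.dy v - 2 * ((a * F.dx v + b * F.dy v) / (a ^ 2 + b ^ 2)) * b := by
  have hc := F.c_pos.ne'
  have hn := F.norm_grad_sq a b
  have hab : a ^ 2 + b ^ 2 ≠ 0 := by
    intro h2
    rcases h with h | h
    · exact h (by nlinarith [sq_nonneg a, sq_nonneg b])
    · exact h (by nlinarith [sq_nonneg a, sq_nonneg b])
  have hin : inner ℝ v (F.grad a b) = a * F.dx v + b * F.dy v := by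
    simp only [grad, dx, dy, inner_add_right, inner_smul_right, real_inner_comm v]
    field_simp
  have h1 : inner ℝ F.e₁ (F.grad a b) = a / F.c := by
    simp only [grad, inner_add_right, inner_smul_right, F.inner_e, F.inner_e₁_self]
    field_simp; ring
  have h2 : inner ℝ F.e₂ (F.grad a b) = b / F.c := by
    simp only [grad, inner_add_right, inner_smul_right, F.inner_e', F.inner_e₂_self]
    field_simp; ring
  have key : (2 * inner ℝ v ν) • ν
      = (2 * (a * F.dx v + b * F.dy v) * (F.c ^ 2 / (a ^ 2 + b ^ 2))) • F.grad a b := by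
    have hs : (‖F.grad a b‖⁻¹) * (‖F.grad a b‖⁻¹) = F.c ^ 2 / (a ^ 2 + b ^ 2) := by
      rw [← mul_inv, ← pow_two, hn, inv_div]
    rw [hν, inner_smul_right, smul_smul, hin, ← hs]
    congr 1; ring
  rw [key]
  constructor
  · simp only [dx, dy, inner_sub_right, inner_smul_right, h1]
    field_simp
  · simp only [dx, dy, inner_sub_right, inner_smul_right, h2]
    field_simp

end PlaneFrame

/-! ### The family of tables and their boundary normals. -/

/-- The three functions of one variable that describe a table: the outer wall is
`x² / 17 + s y = 1`, the obstacle is `y² + p x * y < q x`. Beyond `|y| = 1` the outer wall consists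
of two half ellipses with foci `(±1, 1)` and `(±1, -1)`, and these four points are the only ones
where the obstacle reaches the lines `|y| = 1`. -/
structure TableProfile where
  /-- The outer wall. -/
  s : ℝ → ℝ
  /-- The linear coefficient of the obstacle. -/
  p : ℝ → ℝ
  /-- The constant coefficient of the obstacle. -/
  q : ℝ → ℝ
  contDiff_s : ContDiff ℝ 2 s
  contDiff_p : ContDiff ℝ 2 p
  contDiff_q : ContDiff ℝ 2 q
  s_up : ∀ y, 1 ≤ y → s y = (y - 1) ^ 2 / 16
  s_down : ∀ y, y ≤ -1 → s y = (y + 1) ^ 2 / 16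
  s_nonneg : ∀ y, |y| ≤ 1 → 0 ≤ s y
  s_le : ∀ y, |y| ≤ 1 → s y ≤ 1 / 4
  -- The obstacle function at `y = ±1` is `1 ± p x - q x`, so the next two conditions keep the
  -- obstacle within `|y| ≤ 1` and allow contact only above and below `x = ±1`.
  pq_le : ∀ x, q x + |p x| ≤ 1
  pq_eq : ∀ x, q x + |p x| = 1 → x ^ 2 = 1
  q_nonneg : ∀ x, x ^ 2 ≤ 1 → 0 ≤ q x
  -- The quadratic in `y` has two distinct roots: the obstacle has positive thickness all the way
  -- between the foci and separates the stems.
  disc_pos : ∀ x, x ^ 2 ≤ 1 → 0 < p x ^ 2 / 4 + q x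
  p_out : ∀ x, 1 ≤ x ^ 2 → p x = 0
  q_out : ∀ x, 1 ≤ x ^ 2 → q x = 1 - (x ^ 2 - 1) ^ 2 / 4

namespace TableProfile

/-- The profile of the table reflected in the first axis. -/
def flip (P : TableProfile) : TableProfile where
  s y := P.s (-y)
  p x := -P.p x
  q := P.q
  contDiff_s := P.contDiff_s.comp contDiff_neg
  contDiff_p := P.contDiff_p.neg
  contDiff_q := P.contDiff_q
  s_up y hy := by rw [P.s_down _ (by linarith)]; ring
  s_down y hy := by rw [P.s_up _ (by linarith)]; ring
  s_nonneg y hy := P.s_nonneg _ (by rwa [abs_neg])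
  s_le y hy := P.s_le _ (by rwa [abs_neg])
  pq_le x := by rw [abs_neg]; exact P.pq_le x
  pq_eq x := by rw [abs_neg]; exact P.pq_eq x
  q_nonneg := P.q_nonneg
  disc_pos x hx := by rw [neg_sq]; exact P.disc_pos x hx
  p_out x hx := by rw [P.p_out x hx, neg_zero]
  q_out := P.q_out

variable (P : TableProfile)

theorem abs_p_le (x : ℝ) : |P.p x| ≤ 1 := by
  rcases le_total (x ^ 2) 1 with h | h
  · linarith [P.pq_le x, P.q_nonneg x h]
  · rw [P.p_out x h, abs_zero]; exact zero_le_one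

theorem s_nonneg' (y : ℝ) : 0 ≤ P.s y := by
  rcases le_total (|y|) 1 with h | h
  · exact P.s_nonneg y h
  · rcases le_abs.1 h with h | h
    · rw [P.s_up y h]; positivity
    · rw [P.s_down y (by linarith)]; positivity

/-- The defining function of the obstacle. -/
def phi (x y : ℝ) : ℝ := y ^ 2 + P.p x * y - P.q x

theorem phi_ge {x y : ℝ} (hy : 1 ≤ |y|) : (|y| - 1) * |y| ≤ P.phi x y := by
  have h1 := P.pq_le x
  have h2 : -(|P.p x| * |y|) ≤ P.p x * y := by rw [← abs_mul]; exact neg_abs_le _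
  have h3 := sq_abs y
  have h4 := abs_nonneg (P.p x)
  unfold phi
  nlinarith [P.abs_p_le x]

theorem phi_nonneg {x y : ℝ} (hy : 1 ≤ |y|) : 0 ≤ P.phi x y :=
  (mul_nonneg (by linarith) (by linarith)).trans (P.phi_ge hy)

theorem abs_y_le_of_phi {x y : ℝ} (h : P.phi x y ≤ 0) : |y| ≤ 1 := by
  by_contra! hy
  nlinarith [P.phi_ge (x := x) hy.le]

theorem x_sq_of_phi {x y : ℝ} (hy : 1 ≤ |y|) (h : P.phi x y ≤ 0) : x ^ 2 = 1 := by
  apply P.pq_eq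
  have h1 := P.pq_le x
  have h2 : -(|P.p x| * |y|) ≤ P.p x * y := by rw [← abs_mul]; exact neg_abs_le _
  have h3 := sq_abs y
  have h5 : |y| = 1 := le_antisymm (P.abs_y_le_of_phi h) hy
  unfold phi at h
  rw [h5] at h2 h3
  linarith

theorem phi_out {x y : ℝ} (hx : 1 ≤ x ^ 2) : P.phi x y = y ^ 2 - (1 - (x ^ 2 - 1) ^ 2 / 4) := by
  rw [phi, P.p_out x hx, P.q_out x hx]; ring

theorem x_sq_le_of_phi {x y : ℝ} (h : P.phi x y ≤ 0) : x ^ 2 ≤ 3 := by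
  by_contra! hx
  rw [P.phi_out (by linarith)] at h
  nlinarith [sq_nonneg y]

/-- Since `3 / 17 + 1 / 4 < 1`, the closed obstacle stays off the outer wall, and near each boundary
point a single defining function suffices. -/
theorem outer_of_phi {x y : ℝ} (h : P.phi x y ≤ 0) : x ^ 2 / 17 + P.s y < 1 := by
  linarith [P.x_sq_le_of_phi h, P.s_le y (P.abs_y_le_of_phi h)]

theorem contDiff_phi (F : PlaneFrame) : ContDiff ℝ 2 fun z => P.phi (F.x z) (F.y z) := by
  have hx := F.contDiff_x
  have hy := F.contDiff_y
  exact ((hy.pow 2).add ((P.contDiff_p.comp hx).mul hy)).sub (P.contDiff_q.comp hx)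

/-- The defining function of the outer wall. -/
noncomputable def psi (x y : ℝ) : ℝ := 1 - (x ^ 2 / 17 + P.s y)

theorem contDiff_psi (F : PlaneFrame) : ContDiff ℝ 2 fun z => P.psi (F.x z) (F.y z) := by
  have hx := F.contDiff_x
  have hy := F.contDiff_y
  exact contDiff_const.sub (((hx.pow 2).div_const 17).add (P.contDiff_s.comp hy))

theorem differentiable_s : Differentiable ℝ P.s := P.contDiff_s.differentiable (by norm_num)
theorem differentiable_p : Differentiable ℝ P.p := P.contDiff_p.differentiable (by norm_num)
theorem differentiable_q : Differentiable ℝ P.q := P.contDiff_q.differentiable (by norm_num)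

theorem gradient_phi (F : PlaneFrame) (z : Plane) :
    gradient (fun z => P.phi (F.x z) (F.y z)) z
      = F.grad (deriv P.p (F.x z) * F.y z - deriv P.q (F.x z)) (2 * F.y z + P.p (F.x z)) := by
  apply F.gradient_eq
  have hx := F.hasFDerivAt_x z
  have hy := F.hasFDerivAt_y z
  have hp := (P.differentiable_p (F.x z)).hasDerivAt.comp_hasFDerivAt z hx
  have hq := (P.differentiable_q (F.x z)).hasDerivAt.comp_hasFDerivAt z hx
  refine (((hy.pow 2).add (hp.mul hy)).sub hq).congr_fderiv ?_
  refine ContinuousLinearMap.ext fun w => ?_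
  simp
  ring

theorem gradient_psi (F : PlaneFrame) (z : Plane) :
    gradient (fun z => P.psi (F.x z) (F.y z)) z
      = F.grad (-(2 * F.x z / 17)) (-deriv P.s (F.y z)) := by
  apply F.gradient_eq
  have hx := F.hasFDerivAt_x z
  have hy := F.hasFDerivAt_y z
  have hs := (P.differentiable_s (F.y z)).hasDerivAt.comp_hasFDerivAt z hy
  have h : (fun z => P.psi (F.x z) (F.y z))
      = fun z => 1 - ((17 : ℝ)⁻¹ * F.x z ^ 2 + P.s (F.y z)) := by
    ext w; simp only [psi]; ring
  rw [h]
  refine ((((hx.pow 2).const_mul (17 : ℝ)⁻¹).add hs).const_sub 1).congr_fderiv ?_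
  refine ContinuousLinearMap.ext fun w => ?_
  simp
  ring

/-- At `y = 1` the formula for `s` is known only on the right; differentiability lets the one-sided
derivative decide. -/
theorem deriv_s_up {y : ℝ} (hy : 1 ≤ y) : deriv P.s y = (y - 1) / 8 := by
  have h1 : HasDerivWithinAt P.s (deriv P.s y) (Set.Ici y) y :=
    (P.differentiable_s y).hasDerivAt.hasDerivWithinAt
  have h2 : HasDerivWithinAt P.s ((y - 1) / 8) (Set.Ici y) y := by
    have h3 : HasDerivAt (fun y : ℝ => (y - 1) ^ 2 / 16) ((y - 1) / 8) y := by
      refine ((((hasDerivAt_id y).sub_const 1).pow 2).div_const 16).congr_deriv ?_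
      simp; ring
    exact h3.hasDerivWithinAt.congr (fun w hw => P.s_up w (hy.trans hw)) (P.s_up y hy)
  exact (uniqueDiffWithinAt_Ici y).eq_deriv _ h1 h2

theorem deriv_s_down {y : ℝ} (hy : y ≤ -1) : deriv P.s y = (y + 1) / 8 := by
  have h1 : HasDerivWithinAt P.s (deriv P.s y) (Set.Iic y) y :=
    (P.differentiable_s y).hasDerivAt.hasDerivWithinAt
  have h2 : HasDerivWithinAt P.s ((y + 1) / 8) (Set.Iic y) y := by
    have h3 : HasDerivAt (fun y : ℝ => (y + 1) ^ 2 / 16) ((y + 1) / 8) y := by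
      refine ((((hasDerivAt_id y).add_const 1).pow 2).div_const 16).congr_deriv ?_
      simp; ring
    exact h3.hasDerivWithinAt.congr (fun w hw => P.s_down w (le_trans hw hy)) (P.s_down y hy)
  exact (uniqueDiffWithinAt_Iic y).eq_deriv _ h1 h2

/-- A critical wall point would have `x = 0` and `s y = 1`, hence lie in a cap, where `s` has
nonzero slope off `|y| = 1`. -/
theorem psi_regular {x y : ℝ} (h : P.psi x y = 0) : -(2 * x / 17) ≠ 0 ∨ -deriv P.s y ≠ 0 := by
  by_contra! hcon
  have hx : x = 0 := by linarith [hcon.1]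
  have hs : P.s y = 1 := by simp only [psi, hx] at h; linarith
  have hy : 1 < |y| := by
    by_contra! hy
    linarith [P.s_le y hy]
  rcases lt_abs.1 hy with hy | hy
  · rw [P.deriv_s_up hy.le] at hcon; linarith [hcon.2]
  · rw [P.deriv_s_down (by linarith)] at hcon; linarith [hcon.2]

/-- At a critical point `y` is a double root, so the discriminant vanishes. This is excluded for `x
^ 2 ≤ 1`, and beyond that the explicit `q` has nonzero slope. -/
theorem phi_regular {x y : ℝ} (h : P.phi x y = 0) :
    deriv P.p x * y - deriv P.q x ≠ 0 ∨ 2 * y + P.p x ≠ 0 := by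
  by_contra! hcon
  have hy : y = -P.p x / 2 := by linarith [hcon.2]
  have hD : P.p x ^ 2 / 4 + P.q x = 0 := by
    simp only [phi] at h; rw [hy] at h; linarith
  have hx : 1 < x ^ 2 := by
    by_contra! hx
    linarith [P.disc_pos x hx]
  have hp : P.p x = 0 := P.p_out x hx.le
  have hy0 : y = 0 := by rw [hy, hp]; simp
  have hdq : HasDerivAt P.q (-(x ^ 2 - 1) * x) x := by
    have h3 : HasDerivAt (fun x : ℝ => 1 - (x ^ 2 - 1) ^ 2 / 4) (-(x ^ 2 - 1) * x) x := by
      refine (((((hasDerivAt_pow 2 x).sub_const 1).pow 2).div_const 4).const_sub 1).congr_deriv ?_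
      simp; ring
    refine h3.congr_of_eventuallyEq ?_
    have : ∀ᶠ w in nhds x, 1 < w ^ 2 :=
      (continuous_pow 2).continuousAt.eventually (lt_mem_nhds hx)
    filter_upwards [this] with w hw using P.q_out w hw.le
  have h4 := hcon.1
  rw [hy0, hdq.deriv] at h4
  have : (x ^ 2 - 1) * x = 0 := by linarith
  rcases mul_eq_zero.1 this with h5 | h5
  · linarith
  · rw [h5] at hx; norm_num at hx

/-- The table with a given profile in a given frame. -/
def table (F : PlaneFrame) : Set Plane :=
  {z | 0 ≤ P.psi (F.x z) (F.y z) ∧ 0 ≤ P.phi (F.x z) (F.y z)}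

theorem table_flip (F : PlaneFrame) : P.flip.table F.flip = P.table F := by
  ext z
  simp [table, psi, phi, flip]

theorem isClosed_table (F : PlaneFrame) : IsClosed (P.table F) :=
  (isClosed_le continuous_const (P.contDiff_psi F).continuous).inter
    (isClosed_le continuous_const (P.contDiff_phi F).continuous)

theorem mem_interior_table {F : PlaneFrame} {z : Plane} (h1 : 0 < P.psi (F.x z) (F.y z))
    (h2 : 0 < P.phi (F.x z) (F.y z)) : z ∈ interior (P.table F) := by
  refine mem_interior.2 ⟨{w | 0 < P.psi (F.x w) (F.y w)} ∩ {w | 0 < P.phi (F.x w) (F.y w)},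
    fun w hw => ⟨le_of_lt hw.1, le_of_lt hw.2⟩, ?_, h1, h2⟩
  exact (isOpen_lt continuous_const (P.contDiff_psi F).continuous).inter
    (isOpen_lt continuous_const (P.contDiff_phi F).continuous)

theorem isInwardUnitNormal_psi {F : PlaneFrame} {z : Plane} (h : P.psi (F.x z) (F.y z) = 0) :
    IsInwardUnitNormal (P.table F) z
      (‖F.grad (-(2 * F.x z / 17)) (-deriv P.s (F.y z))‖⁻¹ •
        F.grad (-(2 * F.x z / 17)) (-deriv P.s (F.y z))) := by
  have h2 : 0 < P.phi (F.x z) (F.y z) := by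
    by_contra! h2
    have := P.outer_of_phi h2
    simp only [psi] at h; linarith
  refine ⟨{w | 0 < P.phi (F.x w) (F.y w)}, fun w => P.psi (F.x w) (F.y w),
    isOpen_lt continuous_const (P.contDiff_phi F).continuous, h2, (P.contDiff_psi F).contDiffOn,
    fun w hw => ⟨fun h => h.1, fun h => ⟨h, le_of_lt hw⟩⟩, h, ?_, ?_⟩
  · rw [P.gradient_psi F]; exact F.grad_ne_zero (P.psi_regular h)
  · rw [P.gradient_psi F]

theorem isInwardUnitNormal_phi {F : PlaneFrame} {z : Plane} (h : P.phi (F.x z) (F.y z) = 0) :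
    IsInwardUnitNormal (P.table F) z
      (‖F.grad (deriv P.p (F.x z) * F.y z - deriv P.q (F.x z)) (2 * F.y z + P.p (F.x z))‖⁻¹ •
        F.grad (deriv P.p (F.x z) * F.y z - deriv P.q (F.x z)) (2 * F.y z + P.p (F.x z))) := by
  have h2 : 0 < P.psi (F.x z) (F.y z) := by
    have := P.outer_of_phi h.le
    simp only [psi]; linarith
  refine ⟨{w | 0 < P.psi (F.x w) (F.y w)}, fun w => P.phi (F.x w) (F.y w),
    isOpen_lt continuous_const (P.contDiff_psi F).continuous, h2, (P.contDiff_phi F).contDiffOn,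
    fun w hw => ⟨fun h => h.2, fun h => ⟨le_of_lt hw, h⟩⟩, h, ?_, ?_⟩
  · rw [P.gradient_phi F]; exact F.grad_ne_zero (P.phi_regular h)
  · rw [P.gradient_phi F]

end TableProfile

/-- Interior points have no inward normal. -/
theorem IsInwardUnitNormal.notMem_interior {K : Set Plane} {q ν : Plane}
    (h : IsInwardUnitNormal K q ν) : q ∉ interior K := by
  obtain ⟨U, f, hU, hqU, -, hK, hf0, hg, -⟩ := h
  intro hq
  apply hg
  have hmin : IsLocalMin f q := by
    filter_upwards [hU.mem_nhds hqU, mem_interior_iff_mem_nhds.1 hq] with w hw hwK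
    rw [hf0]; exact (hK w hw).1 hwK
  simp [gradient, hmin.fderiv_eq_zero]

namespace TableProfile

variable (P : TableProfile)

theorem normal_cases {F : PlaneFrame} {z ν : Plane} (hz : z ∈ P.table F)
    (hν : IsInwardUnitNormal (P.table F) z ν) :
    (P.psi (F.x z) (F.y z) = 0 ∧ ν = ‖F.grad (-(2 * F.x z / 17)) (-deriv P.s (F.y z))‖⁻¹ •
        F.grad (-(2 * F.x z / 17)) (-deriv P.s (F.y z))) ∨
      (P.phi (F.x z) (F.y z) = 0 ∧
        ν = ‖F.grad (deriv P.p (F.x z) * F.y z - deriv P.q (F.x z))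
              (2 * F.y z + P.p (F.x z))‖⁻¹ •
            F.grad (deriv P.p (F.x z) * F.y z - deriv P.q (F.x z)) (2 * F.y z + P.p (F.x z))) := by
  rcases hz.1.eq_or_lt with h1 | h1
  · exact Or.inl ⟨h1.symm, hν.unique (P.isInwardUnitNormal_psi h1.symm)⟩
  · rcases hz.2.eq_or_lt with h2 | h2
    · exact Or.inr ⟨h2.symm, hν.unique (P.isInwardUnitNormal_phi h2.symm)⟩
    · exact absurd (P.mem_interior_table h1 h2) hν.notMem_interior

/-- At the foci the obstacle has horizontal tangents. -/
theorem deriv_p_sub_deriv_q {x : ℝ} (hx : x ^ 2 = 1) : deriv P.p x - deriv P.q x = 0 := by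
  have h1 : HasDerivAt (fun w => P.phi w 1) (deriv P.p x - deriv P.q x) x := by
    have h := (((P.differentiable_p x).hasDerivAt.mul_const 1).const_add (1 ^ 2)).sub
      (P.differentiable_q x).hasDerivAt
    rw [mul_one] at h
    exact h
  have h2 : IsLocalMin (fun w => P.phi w 1) x := by
    refine Filter.Eventually.of_forall fun w => ?_
    have h3 : P.phi x 1 = 0 := by rw [P.phi_out hx.ge, hx]; norm_num
    simp only [h3]
    exact P.phi_nonneg (by simp)
  exact h2.hasDerivAt_eq_zero h1

/-! ### Stems, the momentum invariant and darkness. -/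

/-- The part of the table below the upper cap, between the foci and above the obstacle. -/
def stem (F : PlaneFrame) : Set Plane :=
  {z | z ∈ P.table F ∧ F.y z < 1 ∧ F.x z ^ 2 < 1 ∧ 0 < 2 * F.y z + P.p (F.x z)}

/-- Neither equality can occur in the table below `y = 1`: at `x = ±1` the obstacle fills the
heights `0 ≤ y < 1`, and the midline `2 * y + p x = 0` lies inside it. Thus the stem is relatively
clopen there. -/
theorem mem_stem_of_le {F : PlaneFrame} {z : Plane} (hz : z ∈ P.table F) (hy : F.y z < 1)
    (hx : F.x z ^ 2 ≤ 1) (h : 0 ≤ 2 * F.y z + P.p (F.x z)) : z ∈ P.stem F := by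
  have hphi := hz.2
  refine ⟨hz, hy, lt_of_le_of_ne hx fun hx1 => ?_, lt_of_le_of_ne h fun h0 => ?_⟩
  · rw [P.p_out _ hx1.ge] at h
    rw [P.phi_out hx1.ge, hx1] at hphi
    nlinarith
  · have hD := P.disc_pos _ hx
    have hp : P.p (F.x z) = -2 * F.y z := by linarith
    simp only [phi] at hphi
    rw [hp] at hphi hD
    nlinarith

/-- A connected piece of ray below `y = 1` cannot change sides of a relatively clopen set. -/
theorem notMem_stem_of_path {F : PlaneFrame} {z v : Plane} {a b : ℝ}
    (hK : ∀ τ ∈ Set.Icc a b, z + τ • v ∈ P.table F) (hy : ∀ τ ∈ Set.Icc a b, F.y (z + τ • v) < 1)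
    {τ₀ τ₁ : ℝ} (h₀ : τ₀ ∈ Set.Icc a b) (h₁ : τ₁ ∈ Set.Icc a b)
    (hz : z + τ₀ • v ∉ P.stem F) : z + τ₁ • v ∉ P.stem F := by
  set g : ℝ → Plane := fun τ => z + τ • v with hg
  have hgc : Continuous g := by fun_prop
  have hA : IsPreconnected (g '' Set.Icc a b) :=
    isPreconnected_Icc.image g hgc.continuousOn
  have hc : Continuous fun w => 2 * F.y w + P.p (F.x w) :=
    (continuous_const.mul F.continuous_y).add (P.contDiff_p.continuous.comp F.continuous_x)
  have hc2 : Continuous fun w => F.x w ^ 2 := F.continuous_x.pow 2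
  have hU : IsOpen ({w | F.x w ^ 2 < 1} ∩ {w | 0 < 2 * F.y w + P.p (F.x w)}) :=
    (isOpen_lt hc2 continuous_const).inter (isOpen_lt continuous_const hc)
  have hV : IsOpen ({w | 1 < F.x w ^ 2} ∪ {w | 2 * F.y w + P.p (F.x w) < 0}) :=
    (isOpen_lt continuous_const hc2).union (isOpen_lt hc continuous_const)
  have hdis : Disjoint ({w | F.x w ^ 2 < 1} ∩ {w | 0 < 2 * F.y w + P.p (F.x w)})
      ({w | 1 < F.x w ^ 2} ∪ {w | 2 * F.y w + P.p (F.x w) < 0}) := by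
    rw [Set.disjoint_left]
    rintro w ⟨h1, h2⟩ (h3 | h3)
    · exact lt_asymm (Set.mem_ofPred.1 h1) (Set.mem_ofPred.1 h3)
    · exact lt_asymm (Set.mem_ofPred.1 h2) (Set.mem_ofPred.1 h3)
  have hiff : ∀ τ ∈ Set.Icc a b, g τ ∉ P.stem F →
      g τ ∈ {w | 1 < F.x w ^ 2} ∪ {w | 2 * F.y w + P.p (F.x w) < 0} := by
    intro τ hτ h
    by_contra hcon
    rw [Set.mem_union, not_or] at hcon
    exact h (P.mem_stem_of_le (hK τ hτ) (hy τ hτ) (not_lt.1 hcon.1) (not_lt.1 hcon.2))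
  have hsub : g '' Set.Icc a b ⊆ ({w | F.x w ^ 2 < 1} ∩ {w | 0 < 2 * F.y w + P.p (F.x w)}) ∪
      ({w | 1 < F.x w ^ 2} ∪ {w | 2 * F.y w + P.p (F.x w) < 0}) := by
    rintro _ ⟨τ, hτ, rfl⟩
    by_cases h : g τ ∈ P.stem F
    · exact Or.inl h.2.2
    · exact Or.inr (hiff τ hτ h)
  have hall := hA.subset_right_of_subset_union hU hV hdis hsub
    ⟨g τ₀, Set.mem_image_of_mem g h₀, hiff τ₀ h₀ hz⟩
  intro h
  exact Set.disjoint_left.1 hdis h.2.2 (hall (Set.mem_image_of_mem g h₁))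

/-- The product of the angular momenta about the foci `(±1, 1)`, in coordinates. -/
def momenta (x y a b : ℝ) : ℝ := ((x - 1) * b - (y - 1) * a) * ((x + 1) * b - (y - 1) * a)

theorem momenta_move (x y a b t : ℝ) : momenta (x + t * a) (y + t * b) a b = momenta x y a b := by
  simp only [momenta]; ring

/-- Reflection in the ellipse preserves the product of the angular momenta about the foci. -/
theorem momenta_reflect {x y m n : ℝ} (a b : ℝ) (h : x ^ 2 / 17 + (y - 1) ^ 2 / 16 = 1)
    (hm : m = -(2 * x / 17)) (hn : n = -((y - 1) / 8)) :
    momenta x y (a - 2 * ((m * a + n * b) / (m ^ 2 + n ^ 2)) * m)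
      (b - 2 * ((m * a + n * b) / (m ^ 2 + n ^ 2)) * n) = momenta x y a b := by
  have hs : m ^ 2 + n ^ 2 ≠ 0 := by
    intro h0
    have h1 : m = 0 := by nlinarith [sq_nonneg m, sq_nonneg n]
    have h2 : n = 0 := by nlinarith [sq_nonneg m, sq_nonneg n]
    have h3 : x = 0 := by linarith
    have h4 : y - 1 = 0 := by linarith
    rw [h3, h4] at h; norm_num at h
  obtain ⟨l, hl⟩ : ∃ l, l = (m * a + n * b) / (m ^ 2 + n ^ 2) := ⟨_, rfl⟩
  have hl' : l * (m ^ 2 + n ^ 2) = m * a + n * b := by rw [hl]; field_simp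
  rw [← hl]
  -- `momenta` is a quadratic form in `(a, b)`. The identities `e1` and `e2` say that the normal
  -- `(m, n)` is an eigenvector of its symmetric matrix, so reflection along it preserves the form.
  have e1 : (y - 1) ^ 2 * m - x * (y - 1) * n = -(1 - x ^ 2 / 17) * m := by
    subst hm hn; linear_combination (-(2 * x / 17)) * 16 * h + (2 * x / 17) * 17 * h
  have e2 : -(x * (y - 1)) * m + (x ^ 2 - 1) * n = -(1 - x ^ 2 / 17) * n := by
    subst hm hn; ring
  simp only [momenta]
  linear_combination (-4 * l * a + 4 * l ^ 2 * m) * e1 + (-4 * l * b + 4 * l ^ 2 * n) * e2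
    - 4 * l * (1 - x ^ 2 / 17) * hl'

/-- The states of rays that cannot have come from the upper stem. -/
def Outside (F : PlaneFrame) (z v : Plane) : Prop :=
  (F.y z < 1 ∧ z ∉ P.stem F) ∨
    (1 ≤ F.y z ∧ 0 ≤ momenta (F.x z) (F.y z) (F.dx v) (F.dy v) ∧ (F.y z = 1 → F.dy v ≠ 0))

variable {P}

/-- Where the ray meets `y = 1` at abscissa `X`, the invariant is `dy² * (X² - 1)`. A negative value
means a crossing inside the focal segment, and just before it the ray would be in the stem. -/
theorem Outside.enter_cap {F : PlaneFrame} {z v : Plane} {t : ℝ} (ht : 0 ≤ t)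
    (hK : ∀ τ ∈ Set.Icc 0 t, z + τ • v ∈ P.table F) (hy : F.y z < 1) (hz : z ∉ P.stem F)
    (hy' : 1 ≤ F.y (z + t • v)) :
    0 < F.dy v ∧ 0 ≤ momenta (F.x z) (F.y z) (F.dx v) (F.dy v) := by
  rw [F.y_move] at hy'
  have hb : 0 < F.dy v := by
    by_contra! hb
    nlinarith
  refine ⟨hb, ?_⟩
  by_contra! hJ
  obtain ⟨τ₀, hτ₀⟩ : ∃ τ₀, τ₀ = (1 - F.y z) / F.dy v := ⟨_, rfl⟩
  have hτb : τ₀ * F.dy v = 1 - F.y z := by rw [hτ₀]; field_simp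
  have hpos : 0 < τ₀ := by rw [hτ₀]; exact div_pos (by linarith) hb
  have hle : τ₀ ≤ t := by
    by_contra! h
    nlinarith
  have hX : (F.x z + τ₀ * F.dx v) ^ 2 < 1 := by
    by_contra! h
    have : momenta (F.x z) (F.y z) (F.dx v) (F.dy v)
        = F.dy v ^ 2 * ((F.x z + τ₀ * F.dx v) ^ 2 - 1) := by
      have : F.y z - 1 = -(τ₀ * F.dy v) := by linarith
      simp only [momenta, this]; ring
    rw [this] at hJ
    nlinarith [sq_nonneg (F.dy v)]
  have c1 : Continuous fun τ : ℝ => (F.x z + τ * F.dx v) ^ 2 := by fun_prop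
  have c2 : Continuous fun τ : ℝ => F.y z + τ * F.dy v := by fun_prop
  have ev1 := c1.continuousAt.eventually (gt_mem_nhds hX)
  -- As `|p| ≤ 1`, height above `1 / 2` guarantees `0 < 2 * y + p x`.
  have ev2 : ∀ᶠ τ in nhds τ₀, 1 / 2 < F.y z + τ * F.dy v :=
    c2.continuousAt.eventually (lt_mem_nhds (by linarith))
  have ev := ((ev1.and (ev2.and (lt_mem_nhds hpos))).filter_mono nhdsWithin_le_nhds).and
    (self_mem_nhdsWithin (s := Set.Iio τ₀))
  obtain ⟨τ, ⟨h1, h2, h3⟩, h4⟩ := ev.exists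
  have h4 : τ < τ₀ := h4
  have hyl : ∀ σ ∈ Set.Icc 0 τ, F.y (z + σ • v) < 1 := by
    intro σ hσ
    rw [F.y_move]
    nlinarith [hσ.2]
  have hKl : ∀ σ ∈ Set.Icc 0 τ, z + σ • v ∈ P.table F :=
    fun σ hσ => hK σ ⟨hσ.1, by linarith [hσ.2]⟩
  refine P.notMem_stem_of_path hKl hyl ⟨le_rfl, h3.le⟩ ⟨h3.le, le_rfl⟩
    (by rwa [zero_smul, add_zero]) ⟨hKl τ ⟨h3.le, le_rfl⟩, hyl τ ⟨h3.le, le_rfl⟩, ?_, ?_⟩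
  · rw [F.x_move]; exact h1
  · rw [F.y_move]
    linarith [neg_abs_le (P.p (F.x (z + τ • v))), P.abs_p_le (F.x (z + τ • v))]

/-- A nonnegative invariant forces the downward crossing to have `1 ≤ X²`, so just below it the line
is off the stem, and it stays off by connectedness. -/
theorem Outside.leave_cap {F : PlaneFrame} {z v : Plane} {t : ℝ} (ht : 0 ≤ t)
    (hK : ∀ τ ∈ Set.Icc 0 t, z + τ • v ∈ P.table F) (hy : 1 ≤ F.y z)
    (hJ : 0 ≤ momenta (F.x z) (F.y z) (F.dx v) (F.dy v)) (hy' : F.y (z + t • v) < 1) :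
    z + t • v ∉ P.stem F := by
  rw [F.y_move] at hy'
  have hb : F.dy v < 0 := by
    by_contra! hb
    nlinarith
  obtain ⟨τ₀, hτ₀⟩ : ∃ τ₀, τ₀ = (1 - F.y z) / F.dy v := ⟨_, rfl⟩
  have hτb : τ₀ * F.dy v = 1 - F.y z := by
    rw [hτ₀, div_mul_cancel₀ _ hb.ne]
  have hpos : 0 ≤ τ₀ := by rw [hτ₀]; exact div_nonneg_of_nonpos (by linarith) hb.le
  have hlt : τ₀ < t := by
    by_contra! h
    nlinarith
  have hX : 1 ≤ (F.x z + τ₀ * F.dx v) ^ 2 := by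
    by_contra! h
    have : momenta (F.x z) (F.y z) (F.dx v) (F.dy v)
        = F.dy v ^ 2 * ((F.x z + τ₀ * F.dx v) ^ 2 - 1) := by
      have : F.y z - 1 = -(τ₀ * F.dy v) := by linarith
      simp only [momenta, this]; ring
    rw [this] at hJ
    have : 0 < F.dy v ^ 2 := sq_pos_of_neg hb
    nlinarith
  have hev : ∀ᶠ τ in nhdsWithin τ₀ (Set.Ioi τ₀), z + τ • v ∉ P.stem F := by
    rcases hX.lt_or_eq with hX | hX
    · have c1 : Continuous fun τ : ℝ => (F.x z + τ * F.dx v) ^ 2 := by fun_prop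
      filter_upwards [(c1.continuousAt.eventually (lt_mem_nhds hX)).filter_mono
        nhdsWithin_le_nhds] with τ hτ h
      have := h.2.2.1
      rw [F.x_move] at this
      exact lt_asymm this hτ
    -- Crossing exactly at a focus: the obstacle's tangent is horizontal there, so `phi` has
    -- derivative `2 * dy < 0` along the ray and the line runs straight into the obstacle.
    · have d1 : HasDerivAt (fun τ : ℝ => F.x z + τ * F.dx v) (F.dx v) τ₀ := by
        simpa using ((hasDerivAt_id τ₀).mul_const (F.dx v)).const_add (F.x z)
      have d2 : HasDerivAt (fun τ : ℝ => F.y z + τ * F.dy v) (F.dy v) τ₀ := by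
        simpa using ((hasDerivAt_id τ₀).mul_const (F.dy v)).const_add (F.y z)
      have dp := (P.differentiable_p (F.x z + τ₀ * F.dx v)).hasDerivAt.comp τ₀ d1
      have dq := (P.differentiable_q (F.x z + τ₀ * F.dx v)).hasDerivAt.comp τ₀ d1
      have hy1 : F.y z + τ₀ * F.dy v = 1 := by linarith
      have hpq := P.deriv_p_sub_deriv_q hX.symm
      have hp := P.p_out _ hX.le
      have d : HasDerivAt (fun τ : ℝ => P.phi (F.x z + τ * F.dx v) (F.y z + τ * F.dy v))
          (2 * F.dy v) τ₀ := by
        refine (((d2.pow 2).add (dp.mul d2)).sub dq).congr_deriv ?_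
        simp only [Function.comp, hy1, hp]
        simp
        linear_combination F.dx v * hpq
      have h0 : P.phi (F.x z + τ₀ * F.dx v) (F.y z + τ₀ * F.dy v) = 0 := by
        rw [P.phi_out hX.le, ← hX, hy1]; norm_num
      have dw := d.hasDerivWithinAt (s := Set.Ioi τ₀)
      rw [hasDerivWithinAt_iff_tendsto_slope' (by simp)] at dw
      filter_upwards [dw.eventually (gt_mem_nhds (show 2 * F.dy v < 0 by linarith)),
        self_mem_nhdsWithin] with τ h1 h2 h3
      have h4 := h3.1.2
      rw [F.x_move, F.y_move] at h4
      rw [slope_def_field, h0, sub_zero] at h1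
      exact absurd (div_nonneg h4 (sub_nonneg.2 (le_of_lt h2))) (not_le.2 h1)
  obtain ⟨τ, h1, h2⟩ := (hev.and (Ioo_mem_nhdsGT hlt)).exists
  have hyl : ∀ σ ∈ Set.Icc τ t, F.y (z + σ • v) < 1 := by
    intro σ hσ
    rw [F.y_move]
    nlinarith [hσ.1, h2.1]
  exact P.notMem_stem_of_path (fun σ hσ => hK σ ⟨by linarith [hσ.1, h2.1], hσ.2⟩) hyl
    ⟨le_rfl, h2.2.le⟩ ⟨h2.2.le, le_rfl⟩ h1

theorem Outside.move {F : PlaneFrame} {z v : Plane} {t : ℝ} (h : P.Outside F z v) (ht : 0 ≤ t)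
    (hK : segment ℝ z (z + t • v) ⊆ P.table F) : P.Outside F (z + t • v) v := by
  have hK' : ∀ τ ∈ Set.Icc 0 t, z + τ • v ∈ P.table F := by
    intro τ hτ
    apply hK
    rcases ht.eq_or_lt with h0 | h0
    · have : τ = 0 := le_antisymm (by rw [h0]; exact hτ.2) hτ.1
      rw [this, zero_smul, add_zero]
      exact left_mem_segment ℝ _ _
    · rw [segment_eq_image']
      refine ⟨τ / t, ⟨div_nonneg hτ.1 ht, (div_le_one h0).2 hτ.2⟩, ?_⟩
      simp only [add_sub_cancel_left, smul_smul, div_mul_cancel₀ _ h0.ne']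
  have hJ' : momenta (F.x (z + t • v)) (F.y (z + t • v)) (F.dx v) (F.dy v)
      = momenta (F.x z) (F.y z) (F.dx v) (F.dy v) := by
    rw [F.x_move, F.y_move, momenta_move]
  rcases lt_or_ge (F.y (z + t • v)) 1 with hy' | hy'
  · refine Or.inl ⟨hy', ?_⟩
    rcases h with ⟨hy, hz⟩ | ⟨hy, hJ, -⟩
    · refine P.notMem_stem_of_path hK' ?_ ⟨le_rfl, ht⟩ ⟨ht, le_rfl⟩ (by rwa [zero_smul, add_zero])
      intro τ hτ
      rw [F.y_move] at hy' ⊢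
      rcases le_total 0 (F.dy v) with hb | hb
      · nlinarith [hτ.2]
      · nlinarith [hτ.1]
    · exact Outside.leave_cap ht hK' hy hJ hy'
  · refine Or.inr ⟨hy', ?_⟩
    rw [hJ']
    rcases h with ⟨hy, hz⟩ | ⟨hy, hJ, hne⟩
    · obtain ⟨hb, hJ⟩ := Outside.enter_cap ht hK' hy hz hy'
      exact ⟨hJ, fun _ => hb.ne'⟩
    · refine ⟨hJ, fun h1 h0 => hne ?_ h0⟩
      rw [F.y_move, h0, mul_zero, add_zero] at h1
      exact h1

/-- Below `y = 1` the condition ignores the direction. In the cap the wall is the ellipse, which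
preserves the invariant; the obstacle is met only at a focus, where the invariant vanishes for every
direction. -/
theorem Outside.reflect {F : PlaneFrame} {z v ν : Plane} (hz : z ∈ P.table F)
    (h : P.Outside F z v) (hν : IsInwardUnitNormal (P.table F) z ν) :
    P.Outside F z (v - (2 * inner ℝ v ν) • ν) := by
  rcases h with h | ⟨hy, hJ, hne⟩
  · exact Or.inl h
  refine Or.inr ⟨hy, ?_⟩
  rcases P.normal_cases hz hν with ⟨h0, hν⟩ | ⟨h0, hν⟩
  · obtain ⟨e1, e2⟩ := F.reflect_coords (P.psi_regular h0) v ν hν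
    rw [e1, e2, P.deriv_s_up hy]
    refine ⟨?_, ?_⟩
    · rw [momenta_reflect _ _ ?_ rfl rfl]
      · exact hJ
      · simp only [psi, P.s_up _ hy] at h0; linarith
    · intro hy1
      rw [hy1]
      simpa using hne hy1
  · have hx : F.x z ^ 2 = 1 := P.x_sq_of_phi (le_abs.2 (Or.inl hy)) h0.le
    have hy1 : F.y z = 1 := le_antisymm ((le_abs_self _).trans (P.abs_y_le_of_phi h0.le)) hy
    obtain ⟨e1, e2⟩ := F.reflect_coords (P.phi_regular h0) v ν hν
    rw [e1, e2, P.p_out _ hx.ge, hy1, mul_one, P.deriv_p_sub_deriv_q hx]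
    have hb := hne hy1
    refine ⟨?_, fun _ => ?_⟩
    · have hf : ∀ α β : ℝ, momenta (F.x z) 1 α β = 0 := by
        intro α β; simp only [momenta]; linear_combination β ^ 2 * hx
      rw [hf]
    · have : F.dy v - 2 * ((0 * F.dx v + (2 * 1 + 0) * F.dy v) / (0 ^ 2 + (2 * 1 + 0) ^ 2))
          * (2 * 1 + 0) = -F.dy v := by ring
      rw [this]
      exact neg_ne_zero.2 hb

theorem Outside.of_lightRay {F : PlaneFrame} {p z v : Plane} (hp : p ∈ P.table F)
    (hy : F.y p < 1) (hps : p ∉ P.stem F) (h : LightRay (P.table F) p z v) :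
    z ∈ P.table F ∧ P.Outside F z v := by
  induction h with
  | start v _ _ => exact ⟨hp, Or.inl ⟨hy, hps⟩⟩
  | move x v t _ ht hK ih => exact ⟨hK (right_mem_segment ℝ _ _), ih.2.move ht hK⟩
  | reflect x v ν _ hν _ ih => exact ⟨ih.1, ih.2.reflect ih.1 hν⟩

/-- The upper stem is dark for every candle outside the upper cap and the upper stem. -/
theorem isDark_stem {F : PlaneFrame} {p : Plane} (hp : p ∈ P.table F)
    (hy : F.y p < 1) (hps : p ∉ P.stem F) : IsDark (P.table F) p (P.stem F) := by
  intro z hz v h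
  rcases (Outside.of_lightRay hp hy hps h).2 with h1 | h1
  · exact h1.2 hz
  · exact absurd hz.2.1 (not_lt.2 h1.1)

/-- For every candle the upper stem or the lower stem is dark. -/
theorem isDark_stem_or {F : PlaneFrame} {p : Plane} (hp : p ∈ P.table F) :
    IsDark (P.table F) p (P.flip.stem F.flip) ∨ IsDark (P.table F) p (P.stem F) := by
  by_cases h : F.y p < 1 ∧ p ∉ P.stem F
  · exact Or.inr (isDark_stem hp h.1 h.2)
  -- The candle is in the upper cap or the upper stem. Either way `0 < 2 * y + p x`, so after the
  -- flip it is below the cap and off the stem.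
  · left
    rw [← P.table_flip F] at hp ⊢
    have hb := neg_abs_le (P.p (F.x p))
    have hb' := P.abs_p_le (F.x p)
    have hb2 := le_abs_self (P.p (F.x p))
    rw [not_and_or, not_not, not_lt] at h
    refine isDark_stem hp ?_ ?_
    · rw [F.flip_y]
      rcases h with h | h
      · linarith
      · linarith [h.2.2.2]
    · intro hs
      have h2 := hs.2.2.2
      rw [F.flip_y, F.flip_x] at h2
      change 0 < 2 * -F.y p + -P.p (F.x p) at h2
      rcases h with h | h
      · linarith
      · linarith [h.2.2.2]

end TableProfile

/-! ### Compactness, connectedness and boundary of the tables. -/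

namespace TableProfile

variable (P : TableProfile) (F : PlaneFrame)

theorem isCompact_table : IsCompact (P.table F) := by
  refine Metric.isCompact_of_isClosed_isBounded (P.isClosed_table F) ?_
  rw [isBounded_iff_forall_norm_le]
  -- Both coordinates are at most `5` in absolute value: `√17 < 5`, and the caps reach height `1 +
  -- 4`.
  refine ⟨‖F.o‖ + F.c * (5 + 5), fun z hz => ?_⟩
  have h1 := hz.1
  simp only [psi] at h1
  have hs := P.s_nonneg' (F.y z)
  have hx : |F.x z| ≤ 5 := by
    apply abs_le_of_sq_le_sq _ (by norm_num)
    linarith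
  have hy : |F.y z| ≤ 5 := by
    by_contra! hy
    have hx2 := sq_nonneg (F.x z)
    rcases lt_abs.1 hy with hy | hy
    · rw [P.s_up _ (by linarith)] at h1
      nlinarith
    · rw [P.s_down _ (by linarith)] at h1
      nlinarith
  rw [← F.pt_xy z, PlaneFrame.pt]
  refine (norm_add_le _ _).trans (add_le_add le_rfl ?_)
  rw [norm_smul, Real.norm_of_nonneg F.c_pos.le]
  refine mul_le_mul_of_nonneg_left ((norm_add_le _ _).trans (add_le_add ?_ ?_)) F.c_pos.le
  · rwa [norm_smul, F.norm_e₁, mul_one, Real.norm_eq_abs]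
  · rwa [norm_smul, F.norm_e₂, mul_one, Real.norm_eq_abs]

variable {P F}

theorem joinedIn_pt {x y x' y' : ℝ}
    (h : ∀ τ ∈ Set.Icc (0 : ℝ) 1, 0 ≤ P.psi (x + τ * (x' - x)) (y + τ * (y' - y)) ∧
      0 ≤ P.phi (x + τ * (x' - x)) (y + τ * (y' - y))) :
    JoinedIn (P.table F) (F.pt x y) (F.pt x' y') := by
  apply JoinedIn.of_segment_subset
  rw [segment_eq_image']
  rintro _ ⟨τ, hτ, rfl⟩
  have hp : F.pt x y + τ • (F.pt x' y' - F.pt x y)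
      = F.pt (x + τ * (x' - x)) (y + τ * (y' - y)) := by
    simp only [PlaneFrame.pt]; module
  have := h τ hτ
  simp only [hp, table, Set.mem_ofPred_eq, F.x_pt, F.y_pt]
  exact this

theorem psi_nonneg_of_abs_le {x y : ℝ} (hx : x ^ 2 ≤ 4) (hy : |y| ≤ 1) : 0 ≤ P.psi x y := by
  have := P.s_le y hy
  simp only [psi]; linarith

/-- The cap is convex and the obstacle does not intrude into it. -/
theorem joinedIn_of_one_le {x y : ℝ} (h : 0 ≤ P.psi x y) (hy : 1 ≤ y) :
    JoinedIn (P.table F) (F.pt x y) (F.pt 2 1) := by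
  apply joinedIn_pt
  intro τ hτ
  have hY : 1 ≤ y + τ * (1 - y) := by nlinarith [hτ.2]
  refine ⟨?_, P.phi_nonneg (le_abs.2 (Or.inl hY))⟩
  simp only [psi, P.s_up _ hY, P.s_up _ hy] at h ⊢
  have e1 : (x + τ * (2 - x)) ^ 2 ≤ (1 - τ) * x ^ 2 + τ * 4 := by
    nlinarith [mul_nonneg (mul_nonneg hτ.1 (sub_nonneg.2 hτ.2)) (sq_nonneg (x - 2))]
  have e2 : (y + τ * (1 - y) - 1) ^ 2 ≤ (1 - τ) * (y - 1) ^ 2 := by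
    nlinarith [mul_nonneg (mul_nonneg hτ.1 (sub_nonneg.2 hτ.2)) (sq_nonneg (y - 1))]
  nlinarith [mul_nonneg (sub_nonneg.2 hτ.2) h, hτ.1]

/-- Above the vertex of the parabola `phi x ·` its value only grows upwards, so one can rise
vertically into the cap. -/
theorem joinedIn_up {x y : ℝ} (hx : x ^ 2 ≤ 4) (hy : |y| ≤ 1) (hphi : 0 ≤ P.phi x y)
    (h : 0 ≤ 2 * y + P.p x) : JoinedIn (P.table F) (F.pt x y) (F.pt 2 1) := by
  have hy' := abs_le.1 hy
  refine JoinedIn.trans (y := F.pt x 1) ?_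
    (joinedIn_of_one_le (psi_nonneg_of_abs_le hx (by simp)) le_rfl)
  apply joinedIn_pt
  intro τ hτ
  have h1 : 0 ≤ τ * (1 - y) := mul_nonneg hτ.1 (by linarith)
  have h2 : τ * (1 - y) ≤ 1 - y := mul_le_of_le_one_left (by linarith) hτ.2
  rw [sub_self, mul_zero, add_zero]
  refine ⟨psi_nonneg_of_abs_le hx (abs_le.2 ⟨by linarith, by linarith⟩), ?_⟩
  simp only [phi] at hphi ⊢
  nlinarith

theorem joinedIn_poles : JoinedIn (P.table F) (F.pt 2 (-1)) (F.pt 2 1) := by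
  apply joinedIn_pt
  intro τ hτ
  rw [sub_self, mul_zero, add_zero]
  refine ⟨psi_nonneg_of_abs_le (by norm_num) (abs_le.2 ⟨?_, ?_⟩), ?_⟩
  · linarith [hτ.1]
  · linarith [hτ.2]
  · rw [P.phi_out (by norm_num)]
    nlinarith [sq_nonneg (-1 + τ * (1 - -1))]

theorem flip_pt (a b : ℝ) : F.flip.pt a b = F.pt a (-b) := by
  simp [PlaneFrame.pt, PlaneFrame.flip]

theorem joinedIn_of_flip {x y : ℝ}
    (h : JoinedIn (P.flip.table F.flip) (F.flip.pt x (-y)) (F.flip.pt 2 1)) :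
    JoinedIn (P.table F) (F.pt x y) (F.pt 2 1) := by
  rw [P.table_flip, flip_pt, flip_pt, neg_neg] at h
  exact h.trans joinedIn_poles

theorem joinedIn_of_sq_le {x y : ℝ} (hx : x ^ 2 ≤ 4) (hy : |y| ≤ 1) (hphi : 0 ≤ P.phi x y) :
    JoinedIn (P.table F) (F.pt x y) (F.pt 2 1) := by
  rcases le_total 0 (2 * y + P.p x) with h | h
  · exact joinedIn_up hx hy hphi h
  · refine joinedIn_of_flip (joinedIn_up hx (by rwa [abs_neg]) ?_ ?_)
    · simp only [phi, flip] at hphi ⊢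
      linarith
    · simp only [flip]
      linarith

theorem joinedIn_of_mem {x y : ℝ} (hpsi : 0 ≤ P.psi x y) (hphi : 0 ≤ P.phi x y) :
    JoinedIn (P.table F) (F.pt x y) (F.pt 2 1) := by
  rcases le_or_gt (|y|) 1 with hy | hy
  · rcases le_or_gt (x ^ 2) 3 with hx | hx
    · exact joinedIn_of_sq_le (by linarith) hy hphi
    -- Slide horizontally to `e = ±2` on the same side as `x`; all along `3 ≤ X ^ 2`, where there is
    -- no obstacle.
    · obtain ⟨e, he, hxe⟩ : ∃ e : ℝ, e ^ 2 = 4 ∧ 0 ≤ x * e := by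
        rcases le_total 0 x with h | h
        · exact ⟨2, by norm_num, by linarith⟩
        · exact ⟨-2, by norm_num, by linarith⟩
      have hxe3 : 3 ≤ x * e := by
        apply le_of_sq_le_sq _ hxe
        rw [mul_pow, he]; linarith
      have hout : ∀ {X Y : ℝ}, 3 ≤ X ^ 2 → 0 ≤ P.phi X Y := by
        intro X Y hX
        rw [P.phi_out (by linarith)]
        nlinarith [sq_nonneg Y]
      refine JoinedIn.trans (y := F.pt e y) (joinedIn_pt fun τ hτ => ?_)
        (joinedIn_of_sq_le he.le hy (hout (by linarith)))
      rw [sub_self, mul_zero, add_zero]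
      have ha := sub_nonneg.2 hτ.2
      have hb := hτ.1
      have hX : (x + τ * (e - x)) ^ 2
          = (1 - τ) ^ 2 * x ^ 2 + 2 * (τ * (1 - τ)) * (x * e) + τ ^ 2 * e ^ 2 := by ring
      refine ⟨?_, hout ?_⟩
      · have e1 : (x + τ * (e - x)) ^ 2 ≤ (1 - τ) * x ^ 2 + τ * e ^ 2 := by
          nlinarith [mul_nonneg (mul_nonneg hb ha) (sq_nonneg (x - e))]
        have hs := P.s_le y hy
        simp only [psi] at hpsi ⊢
        nlinarith [mul_nonneg ha hpsi]
      · rw [hX, he]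
        nlinarith [mul_le_mul_of_nonneg_left hxe3 (mul_nonneg hb ha),
          mul_le_mul_of_nonneg_left hx.le (sq_nonneg (1 - τ)), sq_nonneg τ]
  · rcases lt_abs.1 hy with hy | hy
    · exact joinedIn_of_one_le hpsi hy.le
    · refine joinedIn_of_flip (joinedIn_of_one_le ?_ hy.le)
      simpa only [psi, flip, neg_neg] using hpsi

variable (P F)

theorem isConnected_table : IsConnected (P.table F) := by
  apply IsPathConnected.isConnected
  have hmem : F.pt 2 1 ∈ P.table F := (joinedIn_poles (P := P) (F := F)).target_mem
  refine ⟨F.pt 2 1, hmem, fun {z} hz => JoinedIn.symm ?_⟩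
  have := joinedIn_of_mem (F := F) hz.1 hz.2
  rwa [F.pt_xy] at this

theorem isClosedBilliardTable : IsClosedBilliardTable (P.table F) where
  isCompact := P.isCompact_table F
  isConnected := P.isConnected_table F
  interior_nonempty := by
    refine ⟨F.pt 0 2, P.mem_interior_table ?_ ?_⟩
    · rw [F.x_pt, F.y_pt, psi, P.s_up _ (by norm_num)]; norm_num
    · rw [F.x_pt, F.y_pt]
      have := P.phi_ge (x := 0) (y := 2) (by norm_num)
      norm_num at this
      linarith
  boundary := by
    intro z hz
    have hzK : z ∈ P.table F := (P.isClosed_table F).frontier_subset hz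
    rcases hzK.1.eq_or_lt with h1 | h1
    · exact ⟨_, P.isInwardUnitNormal_psi h1.symm⟩
    · rcases hzK.2.eq_or_lt with h2 | h2
      · exact ⟨_, P.isInwardUnitNormal_phi h2.symm⟩
      · exact absurd (P.mem_interior_table h1 h2) hz.2

end TableProfile

/-! ### Construction of a profile with a thin, prescribed obstacle. -/

namespace TableProfile

/-- A smooth function of one variable with values in `[0, 1]` and prescribed level sets. -/
theorem exists_contDiff_zero_iff_one_iff {s t : Set ℝ} (hs : IsClosed s) (ht : IsClosed t)
    (hd : Disjoint s t) :
    ∃ f : ℝ → ℝ, ContDiff ℝ 2 f ∧ (∀ x, 0 ≤ f x) ∧ (∀ x, f x ≤ 1) ∧ (∀ x, x ∈ s ↔ f x = 0) ∧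
      ∀ x, x ∈ t ↔ f x = 1 := by
  obtain ⟨f, h1, h2, h3, h4⟩ :=
    exists_contMDiff_zero_iff_one_iff_of_isClosed (modelWithCornersSelf ℝ ℝ) (n := 2) hs ht hd
  exact ⟨f, h1.contDiff, fun x => (h2 ⟨x, rfl⟩).1, fun x => (h2 ⟨x, rfl⟩).2, h3, h4⟩

theorem exists_wall : ∃ s : ℝ → ℝ, ContDiff ℝ 2 s ∧ (∀ y, 1 ≤ y → s y = (y - 1) ^ 2 / 16) ∧
    (∀ y, y ≤ -1 → s y = (y + 1) ^ 2 / 16) ∧ (∀ y, |y| ≤ 1 → 0 ≤ s y) ∧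
    ∀ y, |y| ≤ 1 → s y ≤ 1 / 4 := by
  obtain ⟨χ, hχ, h0, h1, hz, ho⟩ := exists_contDiff_zero_iff_one_iff
    (isClosed_Iic (a := (-1 : ℝ))) (isClosed_Ici (a := (1 : ℝ)))
    (Set.disjoint_left.2 fun x (hx : x ≤ -1) (hx' : 1 ≤ x) => by linarith)
  refine ⟨fun y => χ y * ((y - 1) ^ 2 / 16) + (1 - χ y) * ((y + 1) ^ 2 / 16), by fun_prop,
    fun y hy => ?_, fun y hy => ?_, fun y _ => ?_, fun y hy => ?_⟩
  · simp only [(ho y).1 hy]; ring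
  · simp only [(hz y).1 hy]; ring
  · have := h0 y
    have := sub_nonneg.2 (h1 y)
    positivity
  · have hy' := abs_le.1 hy
    have e1 : (y - 1) ^ 2 / 16 ≤ 1 / 4 := by nlinarith
    have e2 : (y + 1) ^ 2 / 16 ≤ 1 / 4 := by nlinarith
    have := mul_le_mul_of_nonneg_left e1 (h0 y)
    have := mul_le_mul_of_nonneg_left e2 (sub_nonneg.2 (h1 y))
    simp only
    linarith

/-- There is a table whose obstacle is thin near the origin and touches the first axis from above
at prescribed points and from below at others. -/
theorem exists_profile {T₁ T₂ : Set ℝ} (hT₁ : IsClosed T₁) (hT₂ : IsClosed T₂)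
    (hd : Disjoint T₁ T₂) (hT : ∀ x ∈ T₁ ∪ T₂, |x| < 1 / 2) {δ : ℝ} (hδ : 0 < δ) (hδ' : δ < 1) :
    ∃ P : TableProfile, (∀ x, |x| ≤ 1 / 2 → P.q x ≤ δ ^ 2 ∧ |P.p x| ≤ δ) ∧
      (∀ x, x ^ 2 ≤ 1 → (P.q x = 0 ↔ x ∈ T₁ ∪ T₂)) ∧ (∀ x ∈ T₁, P.p x < 0) ∧
      ∀ x ∈ T₂, 0 < P.p x := by
  have hC : IsClosed {x : ℝ | 1 ≤ x ^ 2} := isClosed_le continuous_const (continuous_pow 2)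
  have hTx : ∀ x ∈ T₁ ∪ T₂, x ^ 2 < 1 / 4 := by
    intro x hx
    have := abs_lt.1 (hT x hx)
    nlinarith
  have hTC : ∀ x ∈ T₁ ∪ T₂, ¬ 1 ≤ x ^ 2 := fun x hx h => by linarith [hTx x hx]
  obtain ⟨s, hs, hs1, hs2, hs3, hs4⟩ := exists_wall
  -- `q` is a multiple of `δ ^ 2 * w + (1 - δ ^ 2) * u`: `w` produces its exact zero set, while `u`
  -- vanishes near the origin and restores the full size outside.
  obtain ⟨w, hw, w0, w1, wz, wo⟩ := exists_contDiff_zero_iff_one_iff (hT₁.union hT₂) hC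
    (Set.disjoint_left.2 hTC)
  obtain ⟨u, hu, u0, u1, uz, uo⟩ := exists_contDiff_zero_iff_one_iff
    (isClosed_Icc (a := (-(1 / 2) : ℝ)) (b := 1 / 2)) hC
    (Set.disjoint_left.2 fun x hx (hx' : 1 ≤ x ^ 2) => by nlinarith [hx.1, hx.2])
  -- `f - g` is `-1` on `T₁`, `1` on `T₂` and `0` for `1 ≤ x ^ 2`; it gives `p` its sign.
  obtain ⟨f, hf, f0, f1, fz, fo⟩ := exists_contDiff_zero_iff_one_iff (hT₁.union hC) hT₂
    (Set.disjoint_union_left.2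
      ⟨hd, Set.disjoint_right.2 fun x hx => hTC x (Or.inr hx)⟩)
  obtain ⟨g, hg, g0, g1, gz, go⟩ := exists_contDiff_zero_iff_one_iff (hT₂.union hC) hT₁
    (Set.disjoint_union_left.2
      ⟨hd.symm, Set.disjoint_right.2 fun x hx => hTC x (Or.inl hx)⟩)
  have hδ2 : δ ^ 2 < 1 := by nlinarith
  have hfg : ∀ x, |f x - g x| ≤ 1 := fun x =>
    abs_le.2 ⟨by linarith [f0 x, g1 x], by linarith [f1 x, g0 x]⟩
  have hp : ∀ x, |δ * (f x - g x) * (x ^ 2 - 1) ^ 2 / 8| ≤ δ * ((x ^ 2 - 1) ^ 2 / 8) := by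
    intro x
    rw [abs_div, abs_mul, abs_mul, abs_of_pos hδ, abs_of_nonneg (show 0 ≤ (x ^ 2 - 1) ^ 2 from sq_nonneg _),
      abs_of_pos (by norm_num : (0 : ℝ) < 8)]
    have := mul_le_mul_of_nonneg_right (hfg x) (sq_nonneg (x ^ 2 - 1))
    nlinarith
  have hpo : ∀ x, 1 ≤ x ^ 2 → δ * (f x - g x) * (x ^ 2 - 1) ^ 2 / 8 = 0 := by
    intro x hx
    rw [(fz x).1 (Or.inr hx), (gz x).1 (Or.inr hx)]; ring
  have hqo : ∀ x, 1 ≤ x ^ 2 → (δ ^ 2 * w x + (1 - δ ^ 2) * u x) * (1 - (x ^ 2 - 1) ^ 2 / 4)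
      = 1 - (x ^ 2 - 1) ^ 2 / 4 := by
    intro x hx
    rw [(wo x).1 hx, (uo x).1 hx]; ring
  have hW0 : ∀ x, 0 ≤ δ ^ 2 * w x + (1 - δ ^ 2) * u x := fun x =>
    add_nonneg (mul_nonneg (sq_nonneg _) (w0 x)) (mul_nonneg (by linarith) (u0 x))
  have hW1 : ∀ x, δ ^ 2 * w x + (1 - δ ^ 2) * u x ≤ 1 := fun x => by
    nlinarith [mul_le_mul_of_nonneg_left (w1 x) (sq_nonneg δ), u1 x]
  have hr : ∀ x : ℝ, x ^ 2 ≤ 1 → 3 / 4 ≤ 1 - (x ^ 2 - 1) ^ 2 / 4 := fun x hx => by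
    nlinarith [sq_nonneg x]
  -- The `1 / 8` in `p` spends only half of the margin `(x ^ 2 - 1) ^ 2 / 4` left by `q`, so
  -- equality with `1` remains possible only at `x = ±1`.
  have hle : ∀ x, (δ ^ 2 * w x + (1 - δ ^ 2) * u x) * (1 - (x ^ 2 - 1) ^ 2 / 4)
      + |δ * (f x - g x) * (x ^ 2 - 1) ^ 2 / 8| ≤ 1 - (x ^ 2 - 1) ^ 2 / 8 := by
    intro x
    rcases le_total (x ^ 2) 1 with hx | hx
    · have h1 := mul_le_mul_of_nonneg_right (hW1 x) (by linarith [hr x hx] :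
        0 ≤ 1 - (x ^ 2 - 1) ^ 2 / 4)
      have h2 : δ * ((x ^ 2 - 1) ^ 2 / 8) ≤ 1 * ((x ^ 2 - 1) ^ 2 / 8) :=
        mul_le_mul_of_nonneg_right hδ'.le (by positivity)
      linarith [hp x]
    · rw [hpo x hx, hqo x hx, abs_zero]
      nlinarith [sq_nonneg (x ^ 2 - 1)]
  have hq0 : ∀ x, x ^ 2 ≤ 1 →
      ((δ ^ 2 * w x + (1 - δ ^ 2) * u x) * (1 - (x ^ 2 - 1) ^ 2 / 4) = 0 ↔ x ∈ T₁ ∪ T₂) := by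
    intro x hx
    constructor
    · intro h
      rcases mul_eq_zero.1 h with h | h
      · apply (wz x).2
        have h1 := mul_nonneg (sq_nonneg δ) (w0 x)
        have h2 : 0 ≤ (1 - δ ^ 2) * u x := mul_nonneg (by linarith) (u0 x)
        exact (mul_eq_zero.1 (by linarith : δ ^ 2 * w x = 0)).resolve_left (by positivity)
      · linarith [hr x hx]
    · intro h
      have := hTx x h
      rw [(wz x).1 h, (uz x).1 ⟨by nlinarith, by nlinarith⟩]; ring
  have hneg : ∀ x ∈ T₁, δ * (f x - g x) * (x ^ 2 - 1) ^ 2 / 8 < 0 := by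
    intro x hx
    rw [(fz x).1 (Or.inl hx), (go x).1 hx]
    have h1 : x ^ 2 - 1 < 0 := by linarith [hTx x (Or.inl hx)]
    have := mul_pos hδ (sq_pos_of_neg h1)
    linarith
  have hpos : ∀ x ∈ T₂, 0 < δ * (f x - g x) * (x ^ 2 - 1) ^ 2 / 8 := by
    intro x hx
    rw [(gz x).1 (Or.inl hx), (fo x).1 hx]
    have h1 : x ^ 2 - 1 < 0 := by linarith [hTx x (Or.inr hx)]
    have := mul_pos hδ (sq_pos_of_neg h1)
    linarith
  refine ⟨{ s := s
            p := fun x => δ * (f x - g x) * (x ^ 2 - 1) ^ 2 / 8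
            q := fun x => (δ ^ 2 * w x + (1 - δ ^ 2) * u x) * (1 - (x ^ 2 - 1) ^ 2 / 4)
            contDiff_s := hs
            contDiff_p := by fun_prop
            contDiff_q := by fun_prop
            s_up := hs1
            s_down := hs2
            s_nonneg := hs3
            s_le := hs4
            pq_le := fun x => (hle x).trans (by linarith [sq_nonneg (x ^ 2 - 1)])
            pq_eq := ?_
            q_nonneg := fun x hx => mul_nonneg (hW0 x) (by linarith [hr x hx])
            disc_pos := ?_
            p_out := hpo
            q_out := hqo }, ?_, hq0, hneg, hpos⟩
  · intro x hx
    have := hle x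
    rw [hx] at this
    have h0 : x ^ 2 - 1 = 0 := by
      apply pow_eq_zero_iff two_ne_zero |>.1
      linarith [sq_nonneg (x ^ 2 - 1)]
    linarith
  · intro x hx
    have hq := mul_nonneg (hW0 x) (by linarith [hr x hx] : 0 ≤ 1 - (x ^ 2 - 1) ^ 2 / 4)
    rcases hq.eq_or_lt with h | h
    · have hne : δ * (f x - g x) * (x ^ 2 - 1) ^ 2 / 8 ≠ 0 := by
        rcases (hq0 x hx).1 h.symm with h | h
        · exact (hneg x h).ne
        · exact (hpos x h).ne'
      simp only [← h]
      positivity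
    · positivity
  · intro x hx
    have hx' := abs_le.1 hx
    have hx2 : x ^ 2 ≤ 1 := by nlinarith
    have hq1 : (x ^ 2 - 1) ^ 2 ≤ 1 := by nlinarith [sq_nonneg x]
    constructor
    · simp only [(uz x).1 ⟨hx'.1, hx'.2⟩, mul_zero, add_zero]
      have h1 : δ ^ 2 * w x ≤ δ ^ 2 := mul_le_of_le_one_right (sq_nonneg _) (w1 x)
      refine (mul_le_of_le_one_right (mul_nonneg (sq_nonneg _) (w0 x)) ?_).trans h1
      linarith [sq_nonneg (x ^ 2 - 1)]
    · refine (hp x).trans ?_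
      nlinarith

variable {P : TableProfile} {F : PlaneFrame}

/-- `|y| ^ 2 - δ * |y| - δ ^ 2` is nonnegative from `|y| = 2 * δ` on. -/
theorem phi_nonneg_of_small {x y δ : ℝ} (hδ : 0 ≤ δ) (hq : P.q x ≤ δ ^ 2) (hp : |P.p x| ≤ δ)
    (hy : 2 * δ ≤ |y|) : 0 ≤ P.phi x y := by
  have h2 : -(|P.p x| * |y|) ≤ P.p x * y := by rw [← abs_mul]; exact neg_abs_le _
  have h3 := sq_abs y
  have h4 := mul_le_mul_of_nonneg_right hp (abs_nonneg y)
  unfold phi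
  nlinarith

/-- A table point with `0 ≤ y` below the obstacle's midline must have `y = 0` and `q = 0`; only
there is the sign of `p` needed. -/
theorem inter_table_subset_stem {H : Set Plane} (hy0 : ∀ z ∈ H, 0 ≤ F.y z)
    (hy1 : ∀ z ∈ H, F.y z < 1) (hx : ∀ z ∈ H, F.x z ^ 2 ≤ 1)
    (h : ∀ z ∈ H, F.y z = 0 → P.q (F.x z) = 0 → 0 ≤ P.p (F.x z)) :
    H ∩ P.table F ⊆ P.stem F := by
  rintro z ⟨hz, hK⟩
  refine P.mem_stem_of_le hK (hy1 z hz) (hx z hz) ?_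
  by_contra! hneg
  have h1 := hy0 z hz
  have h2 := P.q_nonneg _ (hx z hz)
  have h3 := hK.2
  simp only [phi] at h3
  have h4 : F.y z * (F.y z + P.p (F.x z)) ≤ 0 :=
    mul_nonpos_of_nonneg_of_nonpos h1 (by linarith)
  have h5 : F.y z * (F.y z + P.p (F.x z)) = 0 := le_antisymm h4 (by linarith)
  have h6 : F.y z = 0 := (mul_eq_zero.1 h5).resolve_right (by linarith)
  linarith [h z hz h6 (by linarith)]

end TableProfile

/-! ### Separating line, adapted frame and thin strips. -/

open scoped Pointwise in
/-- Disjoint convex sets in the plane are weakly separated by a line. -/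
theorem exists_unit_separating {H₁ H₂ : Set Plane} (hc₁ : Convex ℝ H₁) (hc₂ : Convex ℝ H₂)
    (hd : Disjoint H₁ H₂) :
    ∃ e : Plane, ‖e‖ = 1 ∧ ∀ x ∈ H₁, ∀ y ∈ H₂, (inner ℝ e x : ℝ) ≤ inner ℝ e y := by
  suffices h : ∃ v : Plane, v ≠ 0 ∧ ∀ a ∈ H₁ - H₂, (inner ℝ v a : ℝ) ≤ 0 by
    obtain ⟨v, hv, h⟩ := h
    refine ⟨‖v‖⁻¹ • v, norm_smul_inv_norm (𝕜 := ℝ) hv, fun x hx y hy => ?_⟩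
    have := h _ (Set.sub_mem_sub hx hy)
    rw [inner_sub_right] at this
    rw [real_inner_smul_left, real_inner_smul_left]
    exact mul_le_mul_of_nonneg_left (by linarith) (by positivity)
  have hD : Convex ℝ (H₁ - H₂) := hc₁.sub hc₂
  have h0 : (0 : Plane) ∉ H₁ - H₂ := by
    rintro ⟨x, hx, y, hy, hxy⟩
    rw [sub_eq_zero.1 hxy] at hx
    exact Set.disjoint_left.1 hd hx hy
  -- Without interior, the difference set lies in a proper affine subspace; a normal to it has
  -- constant inner product there, and its sign can be chosen.
  rcases (interior (H₁ - H₂)).eq_empty_or_nonempty with hi | hi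
  · rcases (H₁ - H₂).eq_empty_or_nonempty with he | ⟨a₀, ha₀⟩
    · exact ⟨EuclideanSpace.single 0 1, by simp, by simp [he]⟩
    · have hne : (affineSpan ℝ (H₁ - H₂)).direction ≠ ⊤ := by
        rw [Ne, AffineSubspace.direction_eq_top_iff_of_nonempty
          ((affineSpan_nonempty ℝ).2 ⟨a₀, ha₀⟩), ← hD.interior_nonempty_iff_affineSpan_eq_top, hi]
        exact Set.not_nonempty_empty
      obtain ⟨v, hv, hv0⟩ := (Submodule.ne_bot_iff _).1
        (mt Submodule.orthogonal_eq_bot_iff.1 hne)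
      have hconst : ∀ a ∈ H₁ - H₂, (inner ℝ v a : ℝ) = inner ℝ v a₀ := by
        intro a ha
        have := (Submodule.mem_orthogonal' _ _).1 hv _
          (AffineSubspace.vsub_mem_direction (subset_affineSpan ℝ _ ha)
            (subset_affineSpan ℝ _ ha₀))
        rw [vsub_eq_sub, inner_sub_right] at this
        linarith
      rcases le_total (inner ℝ v a₀ : ℝ) 0 with hs | hs
      · exact ⟨v, hv0, fun a ha => by rw [hconst a ha]; exact hs⟩
      · refine ⟨-v, neg_ne_zero.2 hv0, fun a ha => ?_⟩
        rw [inner_neg_left, hconst a ha]; linarith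
  · obtain ⟨f, hf, h⟩ := geometric_hahn_banach_of_nonempty_interior_point hD
      (fun h => h0 (interior_subset h)) hi
    refine ⟨(InnerProductSpace.toDual ℝ Plane).symm f, by simpa using hf, fun a ha => ?_⟩
    rw [InnerProductSpace.toDual_symm_apply]
    simpa using h a ha

/-- A frame with prescribed second axis, origin on that axis, and unit of length. -/
theorem PlaneFrame.exists_frame {e : Plane} (he : ‖e‖ = 1) (d : ℝ) {c : ℝ} (hc : 0 < c) :
    ∃ F : PlaneFrame, F.o = d • e ∧ F.e₂ = e ∧ F.c = c := by
  have hv : Orthonormal ℝ (({1} : Set (Fin 2)).domRestrict fun _ => e) :=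
    ⟨fun _ => he, fun i j hij => absurd (Subsingleton.elim i j) hij⟩
  obtain ⟨b, hb⟩ := hv.exists_orthonormalBasis_extension_of_card_eq (by simp)
  have h1 : b 1 = e := hb 1 rfl
  refine ⟨⟨d • e, b 0, e, c, hc, b.norm_eq_one 0, he, ?_, fun w => ?_⟩, rfl, rfl, rfl⟩
  · rw [← h1]; exact b.orthonormal.2 (by decide)
  · have := b.sum_repr' w
    rw [Fin.sum_univ_two, h1] at this
    exact this.symm

/-- Disjoint bounded convex sets lie on the two sides of the first axis of some frame, close to the
origin. -/
theorem PlaneFrame.exists_separating {H₁ H₂ : Set Plane} (hc₁ : Convex ℝ H₁) (hc₂ : Convex ℝ H₂)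
    (hb₁ : Bornology.IsBounded H₁) (hb₂ : Bornology.IsBounded H₂) (hd : Disjoint H₁ H₂) :
    ∃ F : PlaneFrame, (∀ z ∈ H₁, F.y z ≤ 0) ∧ (∀ z ∈ H₂, 0 ≤ F.y z) ∧
      ∀ z ∈ H₁ ∪ H₂, |F.x z| < 1 / 2 ∧ |F.y z| < 1 / 2 := by
  obtain ⟨e, he, hsep⟩ := exists_unit_separating hc₁ hc₂ hd
  obtain ⟨R, hR⟩ := isBounded_iff_forall_norm_le.1 (hb₁.union hb₂)
  have hin : ∀ z ∈ H₁ ∪ H₂, |(inner ℝ e z : ℝ)| ≤ R := fun z hz => by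
    have := abs_real_inner_le_norm e z
    rw [he, one_mul] at this
    exact this.trans (hR z hz)
  obtain ⟨d, hd₁, hd₂⟩ : ∃ d : ℝ, (∀ x ∈ H₁, (inner ℝ e x : ℝ) ≤ d) ∧
      ∀ y ∈ H₂, d ≤ (inner ℝ e y : ℝ) := by
    rcases H₁.eq_empty_or_nonempty with h₁ | h₁
    · exact ⟨-R, by simp [h₁], fun y hy => (abs_le.1 (hin y (Or.inr hy))).1⟩
    rcases H₂.eq_empty_or_nonempty with h₂ | h₂
    · exact ⟨R, fun x hx => (abs_le.1 (hin x (Or.inl hx))).2, by simp [h₂]⟩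
    obtain ⟨d, h1, h2⟩ := exists_between_of_forall_le (h₁.image fun x => (inner ℝ e x : ℝ))
      (h₂.image fun x => (inner ℝ e x : ℝ)) (by
        rintro _ ⟨x, hx, rfl⟩ _ ⟨y, hy, rfl⟩
        exact hsep x hx y hy)
    exact ⟨d, fun x hx => h1 (Set.mem_image_of_mem _ hx),
      fun y hy => h2 (Set.mem_image_of_mem _ hy)⟩
  -- Points of the sets are within `|R| + |d|` of the origin of the frame, so this unit makes both
  -- coordinates smaller than `1 / 2`.
  have hc : 0 < 2 * (|R| + |d|) + 1 := by positivity
  obtain ⟨F, ho, he₂, hFc⟩ := PlaneFrame.exists_frame he d hc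
  have hy : ∀ z, F.y z = (inner ℝ e z - d) / F.c := fun z => by
    rw [PlaneFrame.y, PlaneFrame.dy, ho, he₂, inner_sub_right, real_inner_smul_right, real_inner_self_eq_norm_sq, he]
    norm_num
  have hbound : ∀ u : Plane, ‖u‖ = 1 → ∀ z ∈ H₁ ∪ H₂,
      |(inner ℝ u (z - F.o) : ℝ) / F.c| < 1 / 2 := by
    intro u hu z hz
    have h1 := abs_real_inner_le_norm u (z - F.o)
    have h2 := norm_sub_le z F.o
    have h3 : ‖F.o‖ = |d| := by rw [ho, norm_smul, he, mul_one, Real.norm_eq_abs]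
    rw [abs_div, abs_of_pos F.c_pos, div_lt_iff₀ F.c_pos, hFc]
    rw [hu, one_mul] at h1
    linarith [hR z hz, le_abs_self R]
  refine ⟨F, fun z hz => ?_, fun z hz => ?_, fun z hz => ?_⟩
  · rw [hy]; exact div_nonpos_of_nonpos_of_nonneg (by linarith [hd₁ z hz]) F.c_pos.le
  · rw [hy]; exact div_nonneg (by linarith [hd₂ z hz]) F.c_pos.le
  · exact ⟨hbound F.e₁ F.norm_e₁ z hz, hbound F.e₂ F.norm_e₂ z hz⟩

open MeasureTheory in
theorem PlaneFrame.volume_axis (F : PlaneFrame) : volume {z | F.y z = 0} = 0 := by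
  have h : {z | F.y z = 0}
      = ((AffineSubspace.mk' F.o (innerSL ℝ F.e₂).ker : AffineSubspace ℝ Plane) : Set Plane) := by
    ext z
    simp [y, dy, F.c_pos.ne', AffineSubspace.mem_mk']
  rw [h]
  refine Measure.addHaar_affineSubspace _ _ fun htop => ?_
  have h1 : F.pt 0 1 ∈ {z | F.y z = 0} := by rw [h, htop]; trivial
  simp at h1

open MeasureTheory Filter in
/-- Thin strips along the first axis have small area in bounded sets. -/
theorem PlaneFrame.eventually_volume_strip_lt (F : PlaneFrame) (R : ℝ) {ε : ℝ} (hε : 0 < ε) :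
    ∀ᶠ δ in nhdsWithin (0 : ℝ) (Set.Ioi 0),
      volume (Metric.closedBall 0 R ∩ {z | |F.y z| ≤ 2 * δ}) < ENNReal.ofReal ε := by
  have hm : ∀ δ : ℝ, MeasurableSet (Metric.closedBall (0 : Plane) R ∩ {z | |F.y z| ≤ 2 * δ}) :=
    fun δ => (Metric.isClosed_closedBall.inter
      (isClosed_le F.continuous_y.abs continuous_const)).measurableSet
  have ht := tendsto_measure_biInter_gt (μ := (volume : Measure Plane)) (a := (0 : ℝ))
    (s := fun δ : ℝ => Metric.closedBall (0 : Plane) R ∩ {z | |F.y z| ≤ 2 * δ})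
    (fun δ _ => (hm δ).nullMeasurableSet)
    (fun i j _ hij z hz => ⟨hz.1, le_trans (Set.mem_ofPred.1 hz.2) (by linarith)⟩)
    ⟨1, one_pos, ((measure_mono Set.inter_subset_left).trans_lt
      measure_closedBall_lt_top).ne⟩
  have h0 : volume (⋂ δ > (0 : ℝ),
      Metric.closedBall (0 : Plane) R ∩ {z | |F.y z| ≤ 2 * δ}) = 0 := by
    refine measure_mono_null (fun z hz => ?_) F.volume_axis
    simp only [Set.mem_iInter] at hz
    by_contra hne
    have hpos : 0 < |F.y z| := abs_pos.2 hne
    have := (hz (|F.y z| / 4) (by positivity)).2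
    simp only [Set.mem_ofPred_eq] at this
    linarith
  rw [h0] at ht
  exact ht.eventually (gt_mem_nhds (ENNReal.ofReal_pos.2 hε))

/-! ### Fitting the table to the two convex sets. -/

theorem corollary3 (H₁ H₂ : Set Plane) (hc₁ : Convex ℝ H₁) (hc₂ : Convex ℝ H₂)
    (hb₁ : Bornology.IsBounded H₁) (hb₂ : Bornology.IsBounded H₂) (hd : Disjoint H₁ H₂)
    (ε : ℝ) (hε : 0 < ε) :
    ∃ K : Set Plane, IsClosedBilliardTable K ∧ SmallOverlap K H₁ ε ∧ SmallOverlap K H₂ ε ∧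
      ∀ p ∈ K, IsDark K p (H₁ ∩ K) ∨ IsDark K p (H₂ ∩ K) := by
  obtain ⟨F, hy₁, hy₂, hF⟩ := PlaneFrame.exists_separating hc₁ hc₂ hb₁ hb₂ hd
  obtain ⟨R, hR⟩ := isBounded_iff_forall_norm_le.1 (hb₁.union hb₂)
  -- Finite nets inside the sets reduce the distance clause to keeping finitely many points in the
  -- table. Net points off the axis are cleared by a small `δ`; those on it become `T₁` and `T₂`.
  obtain ⟨N₁, hN₁, hN₁f, hN₁c⟩ := Metric.finite_approx_of_totallyBounded
    (hb₁.isCompact_closure.totallyBounded.subset subset_closure) ε hε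
  obtain ⟨N₂, hN₂, hN₂f, hN₂c⟩ := Metric.finite_approx_of_totallyBounded
    (hb₂.isCompact_closure.totallyBounded.subset subset_closure) ε hε
  have hev : ∀ᶠ δ in nhdsWithin (0 : ℝ) (Set.Ioi 0), ∀ z ∈ N₁ ∪ N₂, F.y z ≠ 0 →
      2 * δ ≤ |F.y z| := by
    rw [Filter.eventually_all_finite (hN₁f.union hN₂f)]
    intro z _
    by_cases h : F.y z = 0
    · exact Filter.Eventually.of_forall fun _ h' => absurd h h'
    · filter_upwards [Ioo_mem_nhdsGT (show 0 < |F.y z| / 2 by positivity)] with δ hδ _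
      linarith [hδ.2]
  obtain ⟨δ, ⟨hδnet, hδvol⟩, hδ0, hδ1⟩ := ((hev.and (F.eventually_volume_strip_lt R hε)).and
    (Ioo_mem_nhdsGT one_pos)).exists
  set T₁ := F.x '' (N₁ ∩ {z | F.y z = 0}) with hT₁
  set T₂ := F.x '' (N₂ ∩ {z | F.y z = 0}) with hT₂
  have hinj : ∀ {z w : Plane}, F.x z = F.x w → F.y z = 0 → F.y w = 0 → z = w := by
    intro z w h1 h2 h3
    rw [← F.pt_xy z, ← F.pt_xy w, h1, h2, h3]
  have hT : Disjoint T₁ T₂ := by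
    rw [Set.disjoint_left]
    rintro _ ⟨z, ⟨hz, hz0⟩, rfl⟩ ⟨w, ⟨hw, hw0⟩, hwz⟩
    rw [hinj hwz hw0 hz0] at hw
    exact Set.disjoint_left.1 hd (hN₁ hz) (hN₂ hw)
  have hTx : ∀ x ∈ T₁ ∪ T₂, |x| < 1 / 2 := by
    rintro _ (⟨z, ⟨hz, -⟩, rfl⟩ | ⟨z, ⟨hz, -⟩, rfl⟩)
    · exact (hF z (Or.inl (hN₁ hz))).1
    · exact (hF z (Or.inr (hN₂ hz))).1
  obtain ⟨P, hsmall, hq, hneg, hpos⟩ := TableProfile.exists_profile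
    ((hN₁f.inter_of_left _).image F.x).isClosed ((hN₂f.inter_of_left _).image F.x).isClosed
    hT hTx hδ0 hδ1
  have hx2 : ∀ z ∈ H₁ ∪ H₂, F.x z ^ 2 ≤ 1 := fun z hz => by
    have := abs_lt.1 (hF z hz).1
    nlinarith
  have hpsi : ∀ z ∈ H₁ ∪ H₂, 0 ≤ P.psi (F.x z) (F.y z) := fun z hz =>
    TableProfile.psi_nonneg_of_abs_le (by linarith [hx2 z hz]) (by linarith [(hF z hz).2])
  have hfar : ∀ z ∈ H₁ ∪ H₂, 2 * δ ≤ |F.y z| → z ∈ P.table F := fun z hz h => by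
    have hs := hsmall _ (hF z hz).1.le
    exact ⟨hpsi z hz, TableProfile.phi_nonneg_of_small hδ0.le hs.1 hs.2 h⟩
  have hnet : ∀ z ∈ N₁ ∪ N₂, z ∈ H₁ ∪ H₂ → z ∈ P.table F := by
    intro z hz hzH
    by_cases h : F.y z = 0
    · refine ⟨hpsi z hzH, ?_⟩
      have hqz : P.q (F.x z) = 0 := (hq _ (hx2 z hzH)).2
        (hz.imp (fun hz => ⟨z, ⟨hz, h⟩, rfl⟩) fun hz => ⟨z, ⟨hz, h⟩, rfl⟩)
      rw [TableProfile.phi, h, hqz]; simp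
    · exact hfar z hzH (hδnet z hz h)
  have hvol : ∀ H ⊆ H₁ ∪ H₂, MeasureTheory.volume (H \ P.table F) < ENNReal.ofReal ε := by
    intro H hH
    refine (MeasureTheory.measure_mono fun z hz => ?_).trans_lt hδvol
    refine ⟨by simpa using hR z (hH hz.1), ?_⟩
    by_contra hcon
    exact hz.2 (hfar z (hH hz.1) (not_le.1 hcon).le)
  refine ⟨P.table F, P.isClosedBilliardTable F, ⟨hvol _ Set.subset_union_left, fun x hx => ?_⟩,
    ⟨hvol _ Set.subset_union_right, fun x hx => ?_⟩, fun p hp => ?_⟩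
  · obtain ⟨y, hy, hxy⟩ := Set.mem_iUnion₂.1 (hN₁c hx)
    exact ⟨y, ⟨hN₁ hy, hnet y (Or.inl hy) (Or.inl (hN₁ hy))⟩, hxy⟩
  · obtain ⟨y, hy, hxy⟩ := Set.mem_iUnion₂.1 (hN₂c hx)
    exact ⟨y, ⟨hN₂ hy, hnet y (Or.inr hy) (Or.inr (hN₂ hy))⟩, hxy⟩
  · have hlow : H₁ ∩ P.table F ⊆ P.flip.stem F.flip := by
      rw [← P.table_flip F]
      refine TableProfile.inter_table_subset_stem (fun z hz => ?_) (fun z hz => ?_)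
        (fun z hz => hx2 z (Or.inl hz)) (fun z hz h0 hqz => ?_)
      · rw [F.flip_y]; linarith [hy₁ z hz]
      · rw [F.flip_y]; linarith [(abs_lt.1 (hF z (Or.inl hz)).2).1]
      · rw [F.flip_y, neg_eq_zero] at h0
        change 0 ≤ -P.p (F.x z)
        -- An axis point of `H₁` over `T₂` would coincide with a net point of `H₂`, against
        -- disjointness; over `T₁` the sign of `p` is right.
        rcases (hq _ (hx2 z (Or.inl hz))).1 hqz with h | ⟨w, ⟨hw, hw0⟩, hwz⟩
        · linarith [hneg _ h]
        · rw [hinj hwz hw0 h0] at hw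
          exact absurd (hN₂ hw) (Set.disjoint_left.1 hd hz)
    have hupp : H₂ ∩ P.table F ⊆ P.stem F := by
      refine TableProfile.inter_table_subset_stem hy₂ (fun z hz => ?_)
        (fun z hz => hx2 z (Or.inr hz)) (fun z hz h0 hqz => ?_)
      · linarith [(abs_lt.1 (hF z (Or.inr hz)).2).2]
      · rcases (hq _ (hx2 z (Or.inr hz))).1 hqz with ⟨w, ⟨hw, hw0⟩, hwz⟩ | h
        · rw [hinj hwz hw0 h0] at hw
          exact absurd hz (Set.disjoint_left.1 hd (hN₁ hw))
        · exact (hpos _ h).le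
    exact (TableProfile.isDark_stem_or hp).imp (fun h x hx => h x (hlow hx))
      fun h x hx => h x (hupp hx)
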